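/- **Setting.** Graphs are finite and simple; $n$ is the number of vertices, $\Delta$ the maximum degree, $\log$ is the binary logarithm, and $\log^* n$ is the number of times $\log$ must be applied to $n$ until the value is at most $1$. Fix an integer $c\ge 1$; the vertices carry distinct identifiers from $\{0,\dots,n^c-1\}$, chosen adversarially. All algorithms are deterministic and know $n$ and $\Delta$, and local computation is unbounded. A *problem* specifies, for every graph with input labels at its vertices, which labelings of its edges are solutions. * $\mathsf{LOCAL}(t)$ is the class of problems that can be solved within $t(n,\Delta)$ synchronous rounds on every $n$-node graph of maximum degree $\Delta$. A node starts with its identifier and its input; in each round every node sends a message of unbounded size to its neighbors; in the end every node outputs the labels of all its incident edges, and the two endpoints of an edge must agree. * $\mathsf{Edge\text{-}SLOCAL}(\ell)$ is the class of problems that can be solved as follows, for every order of the edges chosen by an adversary. The edges are processed sequentially in this order, and a processed edge $e$ chooses an internal state, which contains its output, based on the edges at distance at most $\ell$ from $e$ (given by the identifiers of their endpoints), the inputs at the endpoints of these edges, and the internal states of those among these edges that were processed before. The distance of two edges is their distance in the line graph. * A $(k,d)$-network decomposition of $G$ is a partition of the vertices into $k$ (possibly empty) classes such that, for each class $V_i$,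 every connected component of $G[V_i]$ has diameter at most $d$. For a constant $a$, $T_{ND}(n)$ is the least number of rounds in which a deterministic LOCAL algorithm that knows $n$ (but not $\Delta$) computes on every $n$-node graph an $(a(\lfloor\log n\rfloor+1),\,a(\lfloor\log n\rfloor+1))$-network decomposition ($T_{ND}(n)=\infty$ if there is no such algorithm). **Corollary.** For every integer $\ell>0$: 1. $\mathsf{Edge\text{-}SLOCAL}(\ell)\subseteq \mathsf{LOCAL}\big(O(\ell\log^2 n+\ell\cdot T_{ND}(n))\big)$, where the hidden constant depends only on $c$ and $a$, not on $\ell$; 2. $\mathsf{Edge\text{-}SLOCAL}(\ell)\subseteq \mathsf{LOCAL}\big(O(\ell\cdot\Delta^{\ell})+O(\log^* n)\big)$, where the constant of the first term depends only on $c$, and that of the second only on $c$ and $\ell$. -/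

import Mathlib

open scoped Classical in
/-- The maximum degree `Δ` of a graph on `n` vertices. -/
noncomputable def graphMaxDegree {n : ℕ} (G : SimpleGraph (Fin n)) : ℕ :=
  G.maxDegree

/-- Unique identifiers of `O(log n)` bits: distinct natural numbers below `n ^ c`. -/
def IsIdAssignment (c : ℕ) {n : ℕ} (ident : Fin n → ℕ) : Prop :=
  Function.Injective ident ∧ ∀ v, ident v < n ^ c

/-- A graph problem whose outputs are labels of the edges: for every `n`-node graph with input
labels `Fin n → I` at the vertices it says which labelings of the edges are solutions. -/
def EdgeProblem (I O : Type) : Type :=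
  ∀ n : ℕ, ∀ G : SimpleGraph (Fin n), (Fin n → I) → (G.edgeSet → O) → Prop

/-! ### The LOCAL model: synchronous message passing with unbounded messages -/

/-- The program run by every node (unbounded local computation, unbounded messages).
A node starts with its identifier and its input. In every round it sends a message to all its
neighbors, receives their messages, each tagged with the identifier of its sender, and updates its
state. Since messages are unbounded, a message may contain a separate part for every neighbor. -/
structure LocalAlg (I R : Type) where
  State : Type
  Msg : Type
  init : ℕ → I → State
  send : State → Msg
  recv : State → Set (ℕ × Msg) → State
  out : State → R

/-- The states of all nodes after the given number of rounds. -/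
def LocalAlg.stateAfter {I R : Type} (A : LocalAlg I R) {n : ℕ} (G : SimpleGraph (Fin n))
    (ident : Fin n → ℕ) (x : Fin n → I) : ℕ → Fin n → A.State
  | 0 => fun v => A.init (ident v) (x v)
  | t + 1 => fun v =>
      A.recv (A.stateAfter G ident x t v)
        {p | ∃ u, G.Adj v u ∧ p = (ident u, A.send (A.stateAfter G ident x t u))}

/-- The output of node `v` if it stops after `t` rounds. -/
def LocalAlg.outputAfter {I R : Type} (A : LocalAlg I R) {n : ℕ} (G : SimpleGraph (Fin n))
    (ident : Fin n → ℕ) (x : Fin n → I) (t : ℕ) (v : Fin n) : R :=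
  A.out (A.stateAfter G ident x t v)

/-- `LOCAL c t`: the edge labeling problems solved by a deterministic LOCAL algorithm within
`t n Δ` rounds on all `n`-node graphs of maximum degree `Δ`, for all identifiers below `n ^ c`.
The nodes know `n` and `Δ`. Every node outputs the labels of all its incident edges (addressed by
the identifier of the other endpoint), so both endpoints of an edge have to output its label. -/
def LOCAL {I O : Type} (c : ℕ) (t : ℕ → ℕ → ℕ∞) : Set (EdgeProblem I O) :=
  {P | ∃ (A : ℕ → ℕ → LocalAlg I (ℕ → Option O)) (r : ℕ → ℕ → ℕ),
    (∀ n Δ, (r n Δ : ℕ∞) ≤ t n Δ) ∧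
    ∀ (n : ℕ) (G : SimpleGraph (Fin n)) (ident : Fin n → ℕ), IsIdAssignment c ident →
      ∀ x : Fin n → I, ∃ y : G.edgeSet → O,
        (∀ (u v : Fin n) (h : G.Adj u v),
          (A n (graphMaxDegree G)).outputAfter G ident x (r n (graphMaxDegree G)) u (ident v)
            = some (y ⟨s(u, v), h⟩)) ∧
        P n G x y}

/-! ### The Edge-SLOCAL model: edges are processed sequentially in adversarial order -/

/-- What an edge sees when it is processed: itself, the edges within the locality radius,
the inputs at the endpoints of these edges, and the internal states of those among these edges that
were processed before. Vertices are known by their identifiers. -/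
structure EdgeView (I S : Type) where
  center : Sym2 ℕ
  edges : Set (Sym2 ℕ)
  inputs : Set (ℕ × I)
  states : Set (Sym2 ℕ × S)

/-- The view of the edge `e` with locality `ℓ`, where `st` holds the internal states of the edges
processed so far. The distance of two edges is their distance in the line graph. -/
def edgeView {I S : Type} {n : ℕ} (G : SimpleGraph (Fin n)) (ident : Fin n → ℕ) (x : Fin n → I)
    (ℓ : ℕ) (st : G.edgeSet → Option S) (e : G.edgeSet) : EdgeView I S where
  center := (e : Sym2 (Fin n)).map ident
  edges := {k | ∃ f : G.edgeSet, G.lineGraph.edist e f ≤ (ℓ : ℕ∞) ∧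
    k = (f : Sym2 (Fin n)).map ident}
  inputs := {p | ∃ f : G.edgeSet, G.lineGraph.edist e f ≤ (ℓ : ℕ∞) ∧
    ∃ v ∈ (f : Sym2 (Fin n)), p = (ident v, x v)}
  states := {p | ∃ (f : G.edgeSet) (s : S), G.lineGraph.edist e f ≤ (ℓ : ℕ∞) ∧
    st f = some s ∧ p = ((f : Sym2 (Fin n)).map ident, s)}

/-- An Edge-SLOCAL algorithm: a processed edge chooses its internal state, which contains its
output, from its view. -/
structure EdgeSLOCALAlg (I O : Type) where
  State : Type
  step : EdgeView I State → State
  out : State → O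

open scoped Classical in
/-- The internal states after processing the edges of the list `L` in this order; `none` stands for
an edge that has not been processed. -/
noncomputable def EdgeSLOCALAlg.run {I O : Type} (A : EdgeSLOCALAlg I O) {n : ℕ}
    (G : SimpleGraph (Fin n)) (ident : Fin n → ℕ) (x : Fin n → I) (ℓ : ℕ)
    (L : List G.edgeSet) : G.edgeSet → Option A.State :=
  L.foldl (fun st e => Function.update st e (some (A.step (edgeView G ident x ℓ st e))))
    (fun _ => none)

/-- `EdgeSLOCAL c ℓ`: the edge labeling problems solved by a deterministic Edge-SLOCAL algorithm
with locality `ℓ` (knowing `n` and `Δ`), for every order in which the edges are processed. -/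
def EdgeSLOCAL {I O : Type} (c ℓ : ℕ) : Set (EdgeProblem I O) :=
  {P | ∃ A : ℕ → ℕ → EdgeSLOCALAlg I O,
    ∀ (n : ℕ) (G : SimpleGraph (Fin n)) (ident : Fin n → ℕ), IsIdAssignment c ident →
      ∀ (x : Fin n → I) (L : List G.edgeSet), L.Nodup → (∀ e, e ∈ L) →
        ∃ y : G.edgeSet → O,
          (∀ e, ((A n (graphMaxDegree G)).run G ident x ℓ L e).map (A n (graphMaxDegree G)).out
            = some (y e)) ∧
          P n G x y}

/-! ### Network decompositions -/

/-- `f` is a `(k, d)`-network decomposition of `G`: it partitions the vertices into `k` (possibly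
empty) classes, and every connected component of the graph induced by a class has diameter at most
`d`. -/
def IsNetworkDecomposition {n : ℕ} (G : SimpleGraph (Fin n)) (k d : ℕ) (f : Fin n → ℕ) : Prop :=
  (∀ v, f v < k) ∧
  ∀ (i : ℕ) (u v : {w : Fin n | f w = i}), (G.induce {w : Fin n | f w = i}).Reachable u v →
    (G.induce {w : Fin n | f w = i}).dist u v ≤ d

/-- The deterministic LOCAL algorithm `A` computes a `(k, d)`-network decomposition of every
`n`-node graph in `t` rounds; every node outputs the index of its class. -/
def LocalAlg.ComputesND (A : LocalAlg Unit ℕ) (c n k d t : ℕ) : Prop :=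
  ∀ (G : SimpleGraph (Fin n)) (ident : Fin n → ℕ), IsIdAssignment c ident →
    IsNetworkDecomposition G k d (A.outputAfter G ident (fun _ => ()) t)

/-- `T_ND(n)`: the least number of rounds in which a deterministic LOCAL algorithm (knowing `n`)
computes an `(O(log n), O(log n))`-network decomposition of every `n`-node graph. Here `O(log n)` is
`a * (log n + 1)` for the constant `a`; the value is `⊤` if no algorithm achieves this. -/
noncomputable def ndTime (c a n : ℕ) : ℕ∞ :=
  ⨅ (t : ℕ) (_ : ∃ A : LocalAlg Unit ℕ,
    A.ComputesND c n (a * (Nat.log 2 n + 1)) (a * (Nat.log 2 n + 1)) t), (t : ℕ∞)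

/-- The iterated logarithm `log* n`: how often the binary logarithm has to be applied until the
value is at most `1`. Rounding up after every step does not change this number. -/
noncomputable def logStar (n : ℕ) : ℕ :=
  sInf {k : ℕ | (Nat.clog 2)^[k] n ≤ 1}

/-!
Everything is transported to graphs on the identifiers. `IdGraph.Agree` says that a vertex cannot tell
two identified graphs apart within `t` rounds; `gather_outputAfter` shows that any quantity which is
constant on such classes of graphs is computed in `t` rounds. This quantity has to be defined on all
identified graphs, but its invariance is only needed at the actual network. So it remains to find an
order of the edges for which the final state of each edge depends on a small ball only.

The edges are sorted by a color `κ`, ties being broken by the identifiers. Then the state of an edge is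
given by a well-founded recursion, `edgeState`. If `κ` is determined by `τ`-balls, takes `K` values, and
every chain of edges of equal color with consecutive distances at most `ℓ = r + 1` has extent at most
`h`, then processing one color moves information by at most `h + r + 2`, and the state of an edge is
determined by a ball of radius `τ + K * (h + r + 2)` (`edgeState_eq_of_agree`). This gives
`mem_LOCAL_of_isScheduling`, and two colorings give the two parts.

* For the first part, the network decomposition algorithm is run on the power `G ^ (ℓ + 1)`, which has
  the same nodes and identifiers, and an edge takes the class of its endpoint with the smaller
  identifier. A chain of nearby edges of one color projects to a connected set of the power graph within
  one class, so `h` is `ℓ + 1` times the diameter bound. If there is no decomposition algorithm, the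
  claimed bound is infinite and a single color does.
* For the second part, `κ` is a proper coloring of the graph that joins edges at distance at most `ℓ`, so
  that `h = 0`. Its degrees are at most `D = 4 * Δ ^ ℓ`. Linial's reduction by polynomials over a prime
  field (`reducesColors_sq`) reaches polynomially many colors in `D` within `logStar n` rounds and then
  `q ^ 2` colors, for a prime `q` of order `D`; the additive reduction `(a, b) ↦ (a, a + b)`
  (`reducesColors_of_sq`) reaches `q` colors in another `q` rounds. The factor in
  `q = O(D)` depends only on `c`: it is chosen so large that the number of colors left after the
  `logStar n` rounds, which depends on `c` through the initial `n ^ (2 * c)` colors, is at most `q ^ 4`.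
-/

open SimpleGraph

namespace EdgeSimulation

/-! ### Distances between edges -/

section Distance

variable {V W : Type*} {G : SimpleGraph V}

lemma edist_le_iff_exists_walk {r : ℕ} {a b : V} :
    G.edist a b ≤ r ↔ ∃ p : G.Walk a b, p.length ≤ r := by
  constructor
  · intro h
    obtain ⟨p, hp⟩ := exists_walk_of_edist_ne_top (ne_top_of_le_ne_top (ENat.natCast_ne_top r) h)
    exact ⟨p, by rw [← hp] at h; exact_mod_cast h⟩
  · rintro ⟨p, hp⟩
    exact (edist_le p).trans (by exact_mod_cast hp)

lemma edist_le_add {r s : ℕ} {a b d : V} (h₁ : G.edist a b ≤ r) (h₂ : G.edist b d ≤ s) :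
    G.edist a d ≤ (r + s : ℕ) := by
  push_cast
  exact SimpleGraph.edist_triangle.trans (add_le_add h₁ h₂)

lemma edist_le_succ_iff {r : ℕ} {a b : V} :
    G.edist a b ≤ (r + 1 : ℕ) ↔ a = b ∨ ∃ a', G.Adj a a' ∧ G.edist a' b ≤ r := by
  constructor
  · intro h
    obtain ⟨p, hp⟩ := edist_le_iff_exists_walk.1 h
    cases p with
    | nil => exact Or.inl rfl
    | cons hadj q =>
      refine Or.inr ⟨_, hadj, edist_le_iff_exists_walk.2 ⟨q, ?_⟩⟩
      simpa using hp
  · rintro (rfl | ⟨a', hadj, h⟩)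
    · simp
    · have h1 : G.edist a a' ≤ (1 : ℕ) := by simp [edist_eq_one_iff_adj.2 hadj]
      rw [add_comm r 1]
      exact edist_le_add h1 h

lemma edist_le_one_of_mem {e : Sym2 V} (he : e ∈ G.edgeSet) {a b : V} (ha : a ∈ e) (hb : b ∈ e) :
    G.edist a b ≤ (1 : ℕ) := by
  induction e with | _ u v
  rw [mem_edgeSet] at he
  rw [Nat.cast_one, edist_le_one_iff_adj_or_eq]
  rw [Sym2.mem_iff] at ha hb
  rcases ha with rfl | rfl <;> rcases hb with rfl | rfl <;> simp [he, he.symm]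

lemma edist_map_embedding (f : V ↪ W) (a b : V) : (G.map f).edist (f a) (f b) = G.edist a b := by
  apply le_antisymm
  · refine le_iInf fun p => ?_
    have := edist_le (p.map (SimpleGraph.Embedding.map f G).toHom)
    rw [Walk.length_map] at this
    exact this
  · refine le_iInf fun p => ?_
    have key : ∀ {x y : W} (p : (G.map f).Walk x y) (a b : V), f a = x → f b = y →
        G.edist a b ≤ p.length := by
      intro x y p
      induction p with
      | nil => intro a b ha hb; simp [f.injective (ha.trans hb.symm)]
      | @cons x z y h q ih =>
        intro a b ha hb
        obtain ⟨a', z', hadj, h1, h2⟩ := (SimpleGraph.map_adj f G _ _).1 h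
        have : a' = a := f.injective (h1.trans ha.symm)
        subst this
        have h3 : G.edist z' b ≤ (q.length : ℕ∞) := ih z' b h2 hb
        exact_mod_cast edist_le_succ_iff.2 (Or.inr ⟨z', hadj, h3⟩)
    exact key p a b rfl rfl

lemma mem_range_of_edist_map_le {f : V ↪ W} {a : V} {y : W} {r : ℕ}
    (h : (G.map f).edist (f a) y ≤ r) : ∃ b, y = f b := by
  induction r generalizing a with
  | zero =>
    have : f a = y := by simpa using h
    exact ⟨a, this.symm⟩
  | succ r ih =>
    rcases edist_le_succ_iff.1 h with h | ⟨z, hz, h⟩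
    · exact ⟨a, h.symm⟩
    · obtain ⟨_, z', _, _, rfl⟩ := (SimpleGraph.map_adj f G _ _).1 hz
      exact ih h

/-- Two edges of the graph that have endpoints at distance at most `r` from each other. For edges,
this says that their distance in the line graph is at most `r + 1`. -/
def EdgesWithin (G : SimpleGraph V) (r : ℕ) (e f : Sym2 V) : Prop :=
  e ∈ G.edgeSet ∧ f ∈ G.edgeSet ∧ ∃ u ∈ e, ∃ w ∈ f, G.edist u w ≤ r

lemma EdgesWithin.symm {r : ℕ} {e f : Sym2 V} (h : EdgesWithin G r e f) : EdgesWithin G r f e := by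
  obtain ⟨he, hf, u, hu, w, hw, huw⟩ := h
  exact ⟨hf, he, w, hw, u, hu, by rwa [edist_comm]⟩

lemma EdgesWithin.edist_le {r : ℕ} {e f : Sym2 V} (h : EdgesWithin G r e f) {a b : V}
    (ha : a ∈ e) (hb : b ∈ f) : G.edist a b ≤ (r + 2 : ℕ) := by
  obtain ⟨he, hf, u, hu, w, hw, huw⟩ := h
  have := edist_le_add (edist_le_add (edist_le_one_of_mem he ha hu) huw)
    (edist_le_one_of_mem hf hw hb)
  rwa [show 1 + r + 1 = r + 2 by ring] at this

lemma lineGraph_edist_le_one {e f : G.edgeSet} {v : V} (he : v ∈ (e : Sym2 V))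
    (hf : v ∈ (f : Sym2 V)) : G.lineGraph.edist e f ≤ (1 : ℕ) := by
  rw [Nat.cast_one, edist_le_one_iff_adj_or_eq]
  by_cases h : e = f
  · exact Or.inr h
  · exact Or.inl ⟨h, v, he, hf⟩

/-- Distances in the line graph in terms of distances in the graph. -/
lemma lineGraph_edist_le_iff {r : ℕ} (e f : G.edgeSet) :
    G.lineGraph.edist e f ≤ (r + 1 : ℕ) ↔ EdgesWithin G r e f := by
  constructor
  · intro h
    refine ⟨e.2, f.2, ?_⟩
    induction r generalizing e with
    | zero =>
      rw [zero_add, Nat.cast_one, edist_le_one_iff_adj_or_eq] at h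
      rcases h with ⟨_, v, h1, h2⟩ | rfl
      · exact ⟨v, h1, v, h2, by simp⟩
      · exact ⟨_, Sym2.out_fst_mem _, _, Sym2.out_fst_mem _, by simp⟩
    | succ r ih =>
      rcases edist_le_succ_iff.1 h with rfl | ⟨g, ⟨_, v, h1, h2⟩, h⟩
      · exact ⟨_, Sym2.out_fst_mem _, _, Sym2.out_fst_mem _, by simp⟩
      · obtain ⟨u, hu, w, hw, huw⟩ := ih g h
        refine ⟨v, h1, w, hw, ?_⟩
        rw [add_comm r 1]
        exact edist_le_add (edist_le_one_of_mem g.2 h2 hu) huw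
  · rintro ⟨-, -, u, hu, w, hw, h⟩
    induction r generalizing e u with
    | zero =>
      have : u = w := by simpa using h
      subst this
      exact lineGraph_edist_le_one hu hw
    | succ r ih =>
      rcases edist_le_succ_iff.1 h with rfl | ⟨u', hadj, h⟩
      · refine (lineGraph_edist_le_one hu hw).trans ?_
        exact_mod_cast Nat.le_add_left _ _
      · have h1 := ih ⟨s(u, u'), hadj⟩ u' (Sym2.mem_mk_right _ _) h
        rw [add_comm (r + 1) 1]
        exact edist_le_add (lineGraph_edist_le_one hu (Sym2.mem_mk_left _ _)) h1

lemma edgesWithin_map (ident : V ↪ W) {r : ℕ} {e f : Sym2 V} :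
    EdgesWithin (G.map ident) r (e.map ident) (f.map ident) ↔ EdgesWithin G r e f := by
  have hE : ∀ e : Sym2 V, e.map ident ∈ (G.map ident).edgeSet ↔ e ∈ G.edgeSet := by
    intro e
    rw [SimpleGraph.edgeSet_map]
    exact (ident.sym2Map.injective.mem_set_image)
  simp only [EdgesWithin, hE, Sym2.mem_map, exists_exists_and_eq_and, edist_map_embedding]

lemma inf_mem (e : Sym2 ℕ) : e.inf ∈ e := by
  induction e with | _ a b
  rcases le_total a b with h | h <;> simp [h]

end Distance

/-! ### Agreement of identified graphs and the gathering algorithm -/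

/-- A graph whose vertices are identifiers, with the inputs of its vertices. All natural numbers are
vertices; those that are not the identifier of a node are isolated and have the input `none`. -/
structure IdGraph (I : Type) where
  graph : SimpleGraph ℕ
  input : ℕ → Option I

/-- The identified graph of a network with identifiers `ident` and inputs `x`. -/
noncomputable def IdGraph.of {I : Type} {n : ℕ} (G : SimpleGraph (Fin n)) (ident : Fin n ↪ ℕ)
    (x : Fin n → I) : IdGraph I where
  graph := G.map ident
  input := Function.extend ident (fun v => some (x v)) (fun _ => none)

/-- `X.Agree Y t a`: the vertex `a` cannot distinguish `X` from `Y` within `t` rounds. -/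
def IdGraph.Agree {I : Type} (X Y : IdGraph I) : ℕ → ℕ → Prop
  | 0, a => X.input a = Y.input a
  | t + 1, a => X.Agree Y t a ∧ (∀ b, X.graph.Adj a b ↔ Y.graph.Adj a b) ∧
      ∀ b, X.graph.Adj a b → X.Agree Y t b

namespace IdGraph

variable {I : Type} {X Y : IdGraph I}

lemma of_input_apply {n : ℕ} (G : SimpleGraph (Fin n)) (ident : Fin n ↪ ℕ) (x : Fin n → I)
    (v : Fin n) : (IdGraph.of G ident x).input (ident v) = some (x v) :=
  ident.injective.extend_apply (fun v => some (x v)) (fun _ => none) v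

lemma Agree.refl (X : IdGraph I) (t a : ℕ) : X.Agree X t a := by
  induction t generalizing a with
  | zero => rfl
  | succ t ih => exact ⟨ih a, fun b => Iff.rfl, fun b _ => ih b⟩

lemma Agree.symm {t a : ℕ} (h : X.Agree Y t a) : Y.Agree X t a := by
  induction t generalizing a with
  | zero => exact Eq.symm h
  | succ t ih =>
    exact ⟨ih h.1, fun b => (h.2.1 b).symm, fun b hb => ih (h.2.2 b ((h.2.1 b).2 hb))⟩

lemma Agree.mono {s t a : ℕ} (hst : s ≤ t) (h : X.Agree Y t a) : X.Agree Y s a := by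
  induction t, hst using Nat.le_induction with
  | base => exact h
  | succ t _ ih => exact ih h.1

lemma Agree.input_eq {t a : ℕ} (h : X.Agree Y t a) : X.input a = Y.input a :=
  h.mono (Nat.zero_le t)

lemma Agree.of_edist_le {r t a b : ℕ} (h : X.Agree Y (r + t) a) (hab : X.graph.edist a b ≤ r) :
    X.Agree Y t b ∧ Y.graph.edist a b ≤ r := by
  induction r generalizing a with
  | zero =>
    have : a = b := by simpa using hab
    subst this
    exact ⟨by simpa using h, by simp⟩
  | succ r ih =>
    rcases edist_le_succ_iff.1 hab with rfl | ⟨a', hadj, h'⟩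
    · exact ⟨h.mono (by omega), by simp⟩
    · rw [Nat.add_right_comm] at h
      obtain ⟨h1, h2⟩ := ih (h.2.2 a' hadj) h'
      exact ⟨h1, edist_le_succ_iff.2 (Or.inr ⟨a', (h.2.1 a').1 hadj, h2⟩)⟩

lemma Agree.mem_edgeSet {a t : ℕ} (h : X.Agree Y (t + 1) a) {e : Sym2 ℕ} (ha : a ∈ e)
    (he : e ∈ X.graph.edgeSet) : e ∈ Y.graph.edgeSet := by
  obtain ⟨b, rfl⟩ := ha
  exact (h.2.1 b).1 he

lemma Agree.edgesWithin {r a : ℕ} (h : X.Agree Y (r + 2) a) {e f : Sym2 ℕ} (ha : a ∈ e)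
    (hef : EdgesWithin X.graph r e f) : EdgesWithin Y.graph r e f := by
  obtain ⟨he, hf, u, hu, w, hw, huw⟩ := hef
  have h1 : X.Agree Y (r + 1) u :=
    (Agree.of_edist_le (by rwa [show 1 + (r + 1) = r + 2 by ring])
      (edist_le_one_of_mem he ha hu)).1
  obtain ⟨h2, h3⟩ := Agree.of_edist_le h1 huw
  exact ⟨h.mem_edgeSet ha he, h2.mem_edgeSet (t := 0) hw hf, u, hu, w, hw, h3⟩

lemma Agree.edgesWithin_iff {r a : ℕ} (h : X.Agree Y (r + 2) a) {e f : Sym2 ℕ} (ha : a ∈ e) :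
    EdgesWithin X.graph r e f ↔ EdgesWithin Y.graph r e f :=
  ⟨h.edgesWithin ha, h.symm.edgesWithin ha⟩

end IdGraph

open Classical in
/-- The algorithm in which every node gathers all it can learn: its state consists of its identifier
and the set of all identified graphs that are consistent with what it has heard. In the end it
evaluates `F` on any one of them. -/
noncomputable def gather {I R : Type} [Inhabited R] (F : IdGraph I → ℕ → R) : LocalAlg I R where
  State := ℕ × Set (IdGraph I)
  Msg := Set (IdGraph I)
  init a i := (a, {Y | Y.input a = some i})
  send s := s.2
  recv s M := (s.1, {Y | Y ∈ s.2 ∧ (∀ b, (∃ m, (b, m) ∈ M) ↔ Y.graph.Adj s.1 b) ∧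
    ∀ p ∈ M, Y ∈ p.2})
  out s := if h : s.2.Nonempty then F h.some s.1 else default

lemma gather_stateAfter {I R : Type} [Inhabited R] (F : IdGraph I → ℕ → R) {n : ℕ}
    (G : SimpleGraph (Fin n)) (ident : Fin n ↪ ℕ) (x : Fin n → I) (t : ℕ) (v : Fin n) :
    (gather F).stateAfter G ident x t v =
      (ident v, {Y | (IdGraph.of G ident x).Agree Y t (ident v)}) := by
  induction t generalizing v with
  | zero =>
    simp only [LocalAlg.stateAfter, gather, IdGraph.Agree, IdGraph.of_input_apply]
    congr 1
    ext Y
    exact eq_comm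
  | succ t ih =>
    have hadj : ∀ b, (IdGraph.of G ident x).graph.Adj (ident v) b ↔
        ∃ u, G.Adj v u ∧ b = ident u := by
      intro b
      rw [IdGraph.of, SimpleGraph.map_adj]
      constructor
      · rintro ⟨u', w, h, h1, rfl⟩
        exact ⟨w, ident.injective h1 ▸ h, rfl⟩
      · rintro ⟨u, h, rfl⟩
        exact ⟨v, u, h, rfl, rfl⟩
    rw [LocalAlg.stateAfter]
    simp only [ih]
    simp only [gather, IdGraph.Agree]
    congr 1
    ext Y
    simp only [Set.mem_ofPred_eq, hadj]
    refine and_congr_right fun _ => and_congr (forall_congr' fun b => ?_) ?_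
    · refine iff_congr ?_ Iff.rfl
      constructor
      · rintro ⟨m, u, h, he⟩
        exact ⟨u, h, congrArg Prod.fst he⟩
      · rintro ⟨u, h, rfl⟩
        exact ⟨_, u, h, rfl⟩
    · constructor
      · rintro h b ⟨u, hu, rfl⟩
        exact h _ ⟨u, hu, rfl⟩
      · rintro h p ⟨u, hu, rfl⟩
        exact h _ ⟨u, hu, rfl⟩

/-- A quantity that each node can determine from its `t`-ball is computed in `t` rounds. -/
lemma gather_outputAfter {I R : Type} [Inhabited R] (F : IdGraph I → ℕ → R) {n : ℕ}
    (G : SimpleGraph (Fin n)) (ident : Fin n ↪ ℕ) (x : Fin n → I) (t : ℕ) (v : Fin n)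
    (hF : ∀ Y, (IdGraph.of G ident x).Agree Y t (ident v) →
      F (IdGraph.of G ident x) (ident v) = F Y (ident v)) :
    (gather F).outputAfter G ident x t v = F (IdGraph.of G ident x) (ident v) := by
  have h : {Y | (IdGraph.of G ident x).Agree Y t (ident v)}.Nonempty :=
    ⟨_, IdGraph.Agree.refl _ t _⟩
  rw [LocalAlg.outputAfter, gather_stateAfter]
  refine (dif_pos h).trans ?_
  exact (hF _ h.some_mem).symm

/-! ### Sequential processing in the order of a coloring -/

/-- The position of an edge in the processing order: edges are sorted by their color, and edges of
the same color by their identifiers. -/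
def edgeRank (κ : Sym2 ℕ → ℕ) (e : Sym2 ℕ) : ℕ ×ₗ ℕ :=
  toLex (κ e, Nat.pair e.inf e.sup)

lemma pair_inf_sup_injective : Function.Injective fun e : Sym2 ℕ => Nat.pair e.inf e.sup := by
  intro e f h
  exact Sym2.inf_eq_inf_and_sup_eq_sup.1 (Nat.pair_eq_pair.1 h)

lemma edgeRank_injective (κ : Sym2 ℕ → ℕ) : Function.Injective (edgeRank κ) := by
  intro e f h
  exact pair_inf_sup_injective (congrArg (fun p => (ofLex p).2) h)

lemma edgeRank_lt {κ : Sym2 ℕ → ℕ} {e f : Sym2 ℕ} (h : edgeRank κ e < edgeRank κ f) :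
    κ e < κ f ∨ κ e = κ f := by
  rcases (Prod.Lex.toLex_lt_toLex).1 h with h | h
  · exact Or.inl h
  · exact Or.inr h.1

/-- The internal state of the edge `e` if the edges are processed with locality `r + 1` in the order
given by `edgeRank κ`. The recursion makes sense on every identified graph, even an infinite one. -/
noncomputable def edgeState {I S : Type} (step : EdgeView I S → S) (r : ℕ) (κ : Sym2 ℕ → ℕ)
    (X : IdGraph I) (e : Sym2 ℕ) : S :=
  step
    { center := e
      edges := {f | EdgesWithin X.graph r e f}
      inputs := {p | ∃ f, EdgesWithin X.graph r e f ∧ p.1 ∈ f ∧ X.input p.1 = some p.2}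
      states := {p | ∃ _ : EdgesWithin X.graph r e p.1 ∧ edgeRank κ p.1 < edgeRank κ e,
        p.2 = edgeState step r κ X p.1} }
termination_by edgeRank κ e
decreasing_by exact (‹_ ∧ _› : _ ∧ _).2

section Run

variable {I O : Type} {n : ℕ} {G : SimpleGraph (Fin n)} {ident : Fin n ↪ ℕ}

lemma mem_edgeSet_map_iff {k : Sym2 ℕ} :
    k ∈ (G.map ident).edgeSet ↔ ∃ f : G.edgeSet, k = (f : Sym2 (Fin n)).map ident := by
  rw [SimpleGraph.edgeSet_map]
  constructor
  · rintro ⟨f, hf, rfl⟩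
    exact ⟨⟨f, hf⟩, rfl⟩
  · rintro ⟨f, rfl⟩
    exact ⟨f, f.2, rfl⟩

lemma edgeView_eq_of_forall_state {S : Type} (x : Fin n → I) (r : ℕ) (κ : Sym2 ℕ → ℕ)
    (step : EdgeView I S → S) (st : G.edgeSet → Option S) (e : G.edgeSet)
    (hst : ∀ (f : G.edgeSet) s, st f = some s ↔
      edgeRank κ ((f : Sym2 (Fin n)).map ident) < edgeRank κ ((e : Sym2 (Fin n)).map ident) ∧
        s = edgeState step r κ (IdGraph.of G ident x) ((f : Sym2 (Fin n)).map ident)) :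
    step (edgeView G ident x (r + 1) st e) =
      edgeState step r κ (IdGraph.of G ident x) ((e : Sym2 (Fin n)).map ident) := by
  have hmap : ∀ f : G.edgeSet, G.lineGraph.edist e f ≤ (r + 1 : ℕ) ↔
      EdgesWithin (G.map ident) r ((e : Sym2 (Fin n)).map ident)
        ((f : Sym2 (Fin n)).map ident) := by
    intro f
    rw [lineGraph_edist_le_iff, edgesWithin_map]
  have hex : ∀ k, EdgesWithin (G.map ident) r ((e : Sym2 (Fin n)).map ident) k →
      ∃ f : G.edgeSet, k = (f : Sym2 (Fin n)).map ident := fun k hk =>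
    mem_edgeSet_map_iff.1 hk.2.1
  rw [edgeState]
  congr 1
  rw [edgeView]
  congr 1
  · ext k
    simp only [Set.mem_ofPred_eq]
    constructor
    · rintro ⟨f, hf, rfl⟩
      exact (hmap f).1 hf
    · intro hk
      obtain ⟨f, rfl⟩ := hex k hk
      exact ⟨f, (hmap f).2 hk, rfl⟩
  · ext ⟨a, i⟩
    simp only [Set.mem_ofPred_eq]
    constructor
    · rintro ⟨f, hf, v, hv, hp⟩
      cases hp
      exact ⟨_, (hmap f).1 hf, Sym2.mem_map.2 ⟨v, hv, rfl⟩, IdGraph.of_input_apply _ _ _ _⟩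
    · rintro ⟨k, hk, ha, hi⟩
      obtain ⟨f, rfl⟩ := hex k hk
      obtain ⟨v, hv, rfl⟩ := Sym2.mem_map.1 ha
      rw [IdGraph.of_input_apply] at hi
      cases hi
      exact ⟨f, (hmap f).2 hk, v, hv, rfl⟩
  · ext ⟨k, s⟩
    simp only [Set.mem_ofPred_eq]
    constructor
    · rintro ⟨f, s', hf, hs, hp⟩
      cases hp
      obtain ⟨h1, h2⟩ := (hst f _).1 hs
      exact ⟨⟨(hmap f).1 hf, h1⟩, h2⟩
    · rintro ⟨⟨hk, hlt⟩, hs⟩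
      obtain ⟨f, rfl⟩ := hex k hk
      exact ⟨f, s, (hmap f).2 hk, (hst f s).2 ⟨hlt, hs⟩, rfl⟩

lemma run_eq_edgeState (A : EdgeSLOCALAlg I O) (x : Fin n → I) (r : ℕ) (κ : Sym2 ℕ → ℕ)
    (L : List G.edgeSet)
    (hL : L.Pairwise fun e f : G.edgeSet => edgeRank κ ((e : Sym2 (Fin n)).map ident) <
      edgeRank κ ((f : Sym2 (Fin n)).map ident))
    (hclosed : ∀ e ∈ L, ∀ f : G.edgeSet, edgeRank κ ((f : Sym2 (Fin n)).map ident) <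
      edgeRank κ ((e : Sym2 (Fin n)).map ident) → f ∈ L)
    (f : G.edgeSet) (s : A.State) :
    A.run G ident x (r + 1) L f = some s ↔
      f ∈ L ∧ s = edgeState A.step r κ (IdGraph.of G ident x) ((f : Sym2 (Fin n)).map ident) := by
  classical
  induction L using List.reverseRecOn generalizing f s with
  | nil => simp [EdgeSLOCALAlg.run]
  | append_singleton L e ih =>
    rw [List.pairwise_append] at hL
    obtain ⟨hL1, -, hL2⟩ := hL
    replace hL2 := fun f hf => hL2 f hf e (List.mem_singleton_self e)
    have hlt : ∀ f : G.edgeSet, edgeRank κ ((f : Sym2 (Fin n)).map ident) <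
        edgeRank κ ((e : Sym2 (Fin n)).map ident) → f ∈ L := by
      intro f hf
      rcases List.mem_append.1 (hclosed e (by simp) f hf) with h | h
      · exact h
      · rw [List.mem_singleton] at h
        subst h
        exact absurd hf (lt_irrefl _)
    have ih' := ih hL1 (fun g hg f hf => hlt f (hf.trans (hL2 g hg)))
    have hstep := edgeView_eq_of_forall_state x r κ A.step (A.run G ident x (r + 1) L) e
      (fun f s => (ih' f s).trans (and_congr_left fun _ => ⟨hL2 f, hlt f⟩))
    have hrun : A.run G ident x (r + 1) (L ++ [e]) =
        Function.update (A.run G ident x (r + 1) L) e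
          (some (A.step (edgeView G ident x (r + 1 : ℕ) (A.run G ident x (r + 1) L) e))) := by
      simp only [EdgeSLOCALAlg.run, List.foldl_append, List.foldl_cons, List.foldl_nil]
    rw [hrun, hstep]
    by_cases hfe : f = e
    · subst hfe
      simp [eq_comm]
    · simp [hfe, ih']

lemma exists_sorted_list {α β : Type*} [Fintype α] [LinearOrder β] (k : α → β)
    (hk : Function.Injective k) :
    ∃ L : List α, L.Nodup ∧ (∀ a, a ∈ L) ∧ L.Pairwise fun a b => k a < k b := by
  let _ : LinearOrder α := LinearOrder.lift' k hk
  refine ⟨Finset.univ.sort, Finset.sort_nodup _ _, fun a => by simp, ?_⟩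
  exact (Finset.sortedLT_sort (Finset.univ : Finset α)).pairwise

/-- The run in the order of `edgeRank κ` computes `edgeState`. -/
lemma exists_list_run_eq (A : EdgeSLOCALAlg I O) (x : Fin n → I) (r : ℕ) (κ : Sym2 ℕ → ℕ) :
    ∃ L : List G.edgeSet, L.Nodup ∧ (∀ e, e ∈ L) ∧ ∀ e : G.edgeSet,
      A.run G ident x (r + 1) L e =
        some (edgeState A.step r κ (IdGraph.of G ident x) ((e : Sym2 (Fin n)).map ident)) := by
  classical
  have hinj : Function.Injective fun e : G.edgeSet =>
      edgeRank κ ((e : Sym2 (Fin n)).map ident) :=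
    (edgeRank_injective κ).comp ((Sym2.map.injective ident.injective).comp Subtype.val_injective)
  obtain ⟨L, h1, h2, h3⟩ := exists_sorted_list _ hinj
  exact ⟨L, h1, h2, fun e => (run_eq_edgeState A x r κ L h3 (fun _ _ f _ => h2 f) e _).2
    ⟨h2 e, rfl⟩⟩

end Run

/-- If the colors are determined by `τ`-balls and every chain of nearby edges of the same color stays
within distance `h`, then the state of an edge of color `i` is determined by the ball of radius
`τ + (i + 1) * (h + r + 2)`: processing a chain moves at most `h` away and one step further to the
next color. Both bounds are needed in `X` only. -/
lemma edgeState_eq_of_agree {I S : Type} (step : EdgeView I S → S) (r τ h : ℕ)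
    (κ : SimpleGraph ℕ → Sym2 ℕ → ℕ) (X Y : IdGraph I)
    (hκ : ∀ e ∈ X.graph.edgeSet, X.Agree Y τ e.inf → κ X.graph e = κ Y.graph e)
    (hchain : ∀ e f, Relation.ReflTransGen
      (fun e f => EdgesWithin X.graph r e f ∧ κ X.graph e = κ X.graph f) e f →
        X.graph.edist e.inf f.inf ≤ h)
    (e : Sym2 ℕ) (he : e ∈ X.graph.edgeSet)
    (hag : X.Agree Y (τ + (κ X.graph e + 1) * (h + r + 2)) e.inf) :
    edgeState step r (κ X.graph) X e = edgeState step r (κ Y.graph) Y e := by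
  induction hi : κ X.graph e using Nat.strong_induction_on generalizing e with
  | _ i ih =>
  subst hi
  have hinner : ∀ f, Relation.ReflTransGen
      (fun e f => EdgesWithin X.graph r e f ∧ κ X.graph e = κ X.graph f) e f →
      f ∈ X.graph.edgeSet → κ X.graph f = κ X.graph e →
      edgeState step r (κ X.graph) X f = edgeState step r (κ Y.graph) Y f := by
    intro f
    induction hf : edgeRank (κ X.graph) f using WellFoundedLT.induction generalizing f with
    | _ p ihp =>
    subst hf
    intro hef hf hc
    have hagf : X.Agree Y ((r + 2) + (τ + κ X.graph e * (h + r + 2))) f.inf := by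
      refine (IdGraph.Agree.of_edist_le (hag.mono (le_of_eq ?_)) (hchain e f hef)).1
      ring
    have hagr : X.Agree Y (r + 2) f.inf := hagf.mono (by omega)
    have hnear : ∀ g, EdgesWithin X.graph r f g →
        X.Agree Y (τ + κ X.graph e * (h + r + 2)) g.inf := fun g hg =>
      (hagf.of_edist_le (hg.edist_le (inf_mem f) (inf_mem g))).1
    have hκf : κ X.graph f = κ Y.graph f := hκ f hf (hagf.mono (by omega))
    have hstate : ∀ g, EdgesWithin X.graph r f g →
        edgeRank (κ X.graph) g < edgeRank (κ X.graph) f →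
        edgeState step r (κ X.graph) X g = edgeState step r (κ Y.graph) Y g := by
      intro g hg hlt
      rcases edgeRank_lt hlt with hlt' | heq
      · rw [hc] at hlt'
        refine ih _ hlt' g hg.2.1 ((hnear g hg).mono ?_) rfl
        exact Nat.add_le_add_left (Nat.mul_le_mul_right _ hlt') _
      · exact ihp _ hlt g rfl (hef.tail ⟨hg, heq.symm⟩) hg.2.1 (heq.trans hc)
    have hrank : ∀ g, EdgesWithin X.graph r f g →
        (edgeRank (κ X.graph) g < edgeRank (κ X.graph) f ↔
          edgeRank (κ Y.graph) g < edgeRank (κ Y.graph) f) := by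
      intro g hg
      rw [edgeRank, edgeRank, edgeRank, edgeRank, ← hκf,
        ← hκ g hg.2.1 ((hnear g hg).mono (by omega))]
    rw [edgeState, edgeState]
    congr 2
    · ext g
      exact hagr.edgesWithin_iff (inf_mem f)
    · ext ⟨a, i⟩
      simp only [Set.mem_ofPred_eq]
      refine exists_congr fun g => ?_
      rw [← hagr.edgesWithin_iff (inf_mem f)]
      refine and_congr_right fun hg => and_congr_right fun ha => ?_
      rw [(IdGraph.Agree.of_edist_le (t := 0) hagr (hg.edist_le (inf_mem f) ha)).1.input_eq]
    · ext ⟨g, s⟩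
      simp only [Set.mem_ofPred_eq, exists_prop]
      rw [← hagr.edgesWithin_iff (inf_mem f)]
      constructor
      · rintro ⟨⟨hg, hlt⟩, rfl⟩
        exact ⟨⟨hg, (hrank g hg).1 hlt⟩, hstate g hg hlt⟩
      · rintro ⟨⟨hg, hlt⟩, rfl⟩
        exact ⟨⟨hg, (hrank g hg).2 hlt⟩, (hstate g hg ((hrank g hg).2 hlt)).symm⟩
  exact hinner e Relation.ReflTransGen.refl he rfl

/-- An edge coloring scheme that lets networks with `n` nodes and maximum degree `Δ` simulate
sequential processing with locality `r + 1`: the colors are determined by `τ`-balls, are less than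
`K`, and chains of nearby edges of the same color have extent at most `h`. -/
def IsScheduling (c n Δ r τ K h : ℕ) (κ : SimpleGraph ℕ → Sym2 ℕ → ℕ) : Prop :=
  ∀ (G : SimpleGraph (Fin n)) (ident : Fin n ↪ ℕ), graphMaxDegree G = Δ →
    IsIdAssignment c ident →
    (∀ (I : Type) (X Y : IdGraph I), X.graph = G.map ident → ∀ e ∈ X.graph.edgeSet,
      X.Agree Y τ e.inf → κ X.graph e = κ Y.graph e) ∧
    (∀ e ∈ (G.map ident).edgeSet, κ (G.map ident) e < K) ∧
    ∀ e f, Relation.ReflTransGen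
      (fun e f => EdgesWithin (G.map ident) r e f ∧ κ (G.map ident) e = κ (G.map ident) f) e f →
        (G.map ident).edist e.inf f.inf ≤ h

/-- Simulation of sequential edge processing by a scheduling. -/
theorem mem_LOCAL_of_isScheduling {I O : Type} {c r : ℕ} {t : ℕ → ℕ → ℕ∞} {P : EdgeProblem I O}
    (hP : P ∈ (EdgeSLOCAL c (r + 1) : Set (EdgeProblem I O)))
    (H : ∀ n Δ, (∀ G : SimpleGraph (Fin n), graphMaxDegree G = Δ → G = ⊥) ∨
      ∃ τ K h κ, IsScheduling c n Δ r τ K h κ ∧ ((τ + K * (h + r + 2) + 1 : ℕ) : ℕ∞) ≤ t n Δ) :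
    P ∈ (LOCAL c t : Set (EdgeProblem I O)) := by
  classical
  obtain ⟨S, hS⟩ := hP
  -- Without edges there is nothing to output, and zero rounds suffice.
  have H' : ∀ n Δ, ∃ (R : ℕ) (κ : SimpleGraph ℕ → Sym2 ℕ → ℕ), (R : ℕ∞) ≤ t n Δ ∧
      ((∀ G : SimpleGraph (Fin n), graphMaxDegree G = Δ → G = ⊥) ∨
        ∃ τ K h, IsScheduling c n Δ r τ K h κ ∧ R = τ + K * (h + r + 2) + 1) := by
    intro n Δ
    rcases H n Δ with h | ⟨τ, K, h, κ, h1, h2⟩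
    · exact ⟨0, fun _ _ => 0, by simp, Or.inl h⟩
    · exact ⟨_, κ, h2, Or.inr ⟨τ, K, h, h1, rfl⟩⟩
  choose R κ hR hκ using H'
  let F : ℕ → ℕ → IdGraph I → ℕ → ℕ → Option O := fun n Δ X a b =>
    if X.graph.Adj a b then
      some ((S n Δ).out (edgeState (S n Δ).step r (κ n Δ X.graph) X s(a, b)))
    else none
  refine ⟨fun n Δ => gather (F n Δ), R, hR, ?_⟩
  intro n G ident₀ hid x
  obtain ⟨ident, rfl⟩ : ∃ ident : Fin n ↪ ℕ, ident₀ = ident := ⟨⟨ident₀, hid.1⟩, rfl⟩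
  set Δ := graphMaxDegree G with hΔ
  set X := IdGraph.of G ident x with hX
  obtain ⟨L, hL1, hL2, hL3⟩ := exists_list_run_eq (G := G) (ident := ident) (S n Δ) x r
    (κ n Δ X.graph)
  obtain ⟨y, hy, hPy⟩ := hS n G ident hid x L hL1 hL2
  refine ⟨y, ?_, hPy⟩
  intro u v huv
  have hadj : X.graph.Adj (ident u) (ident v) := SimpleGraph.map_adj_apply.2 huv
  rcases hκ n Δ with hbot | ⟨τ, K, h, hsch, hRe⟩
  · rw [hbot G rfl] at huv
    exact absurd huv (by simp)
  · obtain ⟨h1, h2, h3⟩ := hsch G ident rfl hid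
    rw [gather_outputAfter]
    · change F n Δ X (ident u) (ident v) = _
      rw [show F n Δ X (ident u) (ident v) = _ from if_pos hadj]
      have := hy ⟨s(u, v), huv⟩
      rw [← hΔ, hL3] at this
      exact this
    · intro Y hag
      rw [hRe] at hag
      funext b
      change (if X.graph.Adj (ident u) b then _ else _) = if Y.graph.Adj (ident u) b then _ else _
      rw [← hag.2.1 b]
      split_ifs with hb
      · congr 2
        refine edgeState_eq_of_agree _ r τ h (κ n Δ) X Y (h1 I X Y rfl) h3 _ hb ?_
        have hle := h2 s(ident u, b) hb
        refine (IdGraph.Agree.of_edist_le (r := 1) (hag.mono ?_)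
          (edist_le_one_of_mem hb (Sym2.mem_mk_left _ _) (inf_mem _))).1
        rw [add_comm 1]
        exact Nat.add_le_add_right (Nat.add_le_add_left (Nat.mul_le_mul_right _ hle) _) _
      · rfl

/-! ### Scheduling by a network decomposition of a power graph -/

/-- The graph joining the vertices of `G` at distance between `1` and `k`. -/
def distPower {V : Type*} (G : SimpleGraph V) (k : ℕ) : SimpleGraph V where
  Adj a b := a ≠ b ∧ G.edist a b ≤ k
  symm.symm a b h := ⟨h.1.symm, by rw [edist_comm]; exact h.2⟩
  loopless.irrefl a h := h.1 rfl

lemma distPower_map {V W : Type*} (G : SimpleGraph V) (ident : V ↪ W) (k : ℕ) :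
    (distPower G k).map ident = distPower (G.map ident) k := by
  ext a b
  rw [SimpleGraph.map_adj]
  constructor
  · rintro ⟨u, v, ⟨h1, h2⟩, rfl, rfl⟩
    exact ⟨ident.injective.ne h1, by rwa [edist_map_embedding]⟩
  · rintro ⟨h1, h2⟩
    obtain ⟨a', rfl⟩ : ∃ a', ident a' = a := by
      obtain ⟨p, -⟩ := edist_le_iff_exists_walk.1 h2
      cases p with
      | nil => exact absurd rfl h1
      | cons hadj _ =>
        obtain ⟨u, _, _, h, _⟩ := (SimpleGraph.map_adj ident G _ _).1 hadj
        exact ⟨u, h⟩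
    obtain ⟨b', rfl⟩ := mem_range_of_edist_map_le h2
    exact ⟨a', b', ⟨fun h => h1 (h ▸ rfl), by rwa [edist_map_embedding] at h2⟩, rfl, rfl⟩

lemma edist_le_of_walk_induce_distPower {V : Type*} {G : SimpleGraph V} {k : ℕ} {s : Set V} {u v : s}
    (p : ((distPower G k).induce s).Walk u v) : G.edist (u : V) v ≤ (k * p.length : ℕ) := by
  induction p with
  | nil => simp
  | cons hadj q ih =>
    rw [Walk.length_cons, mul_add, mul_one, add_comm]
    exact edist_le_add hadj.2 ih

/-- The states of a LOCAL algorithm without inputs on a graph whose vertices are identifiers. -/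
def idState {R : Type} (A : LocalAlg Unit R) (H : SimpleGraph ℕ) : ℕ → ℕ → A.State
  | 0, a => A.init a ()
  | t + 1, a => A.recv (idState A H t a) {p | ∃ b, H.Adj a b ∧ p = (b, A.send (idState A H t b))}

lemma stateAfter_eq_idState {R : Type} (A : LocalAlg Unit R) {n : ℕ} (G : SimpleGraph (Fin n))
    (ident : Fin n ↪ ℕ) (t : ℕ) (v : Fin n) :
    A.stateAfter G ident (fun _ => ()) t v = idState A (G.map ident) t (ident v) := by
  induction t generalizing v with
  | zero => rfl
  | succ t ih =>
    simp only [LocalAlg.stateAfter, idState, ih]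
    congr 1
    ext p
    simp only [Set.mem_ofPred_eq, SimpleGraph.map_adj]
    constructor
    · rintro ⟨u, h, rfl⟩
      exact ⟨_, ⟨v, u, h, rfl, rfl⟩, rfl⟩
    · rintro ⟨_, ⟨v', u, h, h1, rfl⟩, rfl⟩
      exact ⟨u, ident.injective h1 ▸ h, rfl⟩

/-- One round on the `k`-th power of a graph takes `k` rounds on the graph. -/
lemma idState_distPower_eq_of_agree {I R : Type} (A : LocalAlg Unit R) {X Y : IdGraph I} {k t a : ℕ}
    (h : X.Agree Y (k * t) a) :
    idState A (distPower X.graph k) t a = idState A (distPower Y.graph k) t a := by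
  induction t generalizing a with
  | zero => rfl
  | succ t ih =>
    rw [mul_add, mul_one, add_comm] at h
    rw [idState, idState, ih (h.mono (by omega))]
    have hb : ∀ b, (distPower X.graph k).Adj a b ↔ (distPower Y.graph k).Adj a b := by
      intro b
      have h' : X.Agree Y (k + 0) a := h.mono (by omega)
      exact and_congr_right fun _ =>
        ⟨fun hab => (h'.of_edist_le hab).2, fun hab => (h'.symm.of_edist_le hab).2⟩
    congr 1
    ext p
    simp only [Set.mem_ofPred_eq, ← hb]
    refine exists_congr fun b => and_congr_right fun hab => ?_
    rw [ih (h.of_edist_le hab.2).1]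

lemma exists_inf_eq {n : ℕ} {G : SimpleGraph (Fin n)} {ident : Fin n ↪ ℕ} {e : Sym2 ℕ}
    (he : e ∈ (G.map ident).edgeSet) : ∃ u, e.inf = ident u := by
  obtain ⟨f, rfl⟩ := mem_edgeSet_map_iff.1 he
  obtain ⟨u, -, hu⟩ := Sym2.mem_map.1 (inf_mem ((f : Sym2 (Fin n)).map ident))
  exact ⟨u, hu.symm⟩

/-- Chains of nearby edges of the same color project to connected sets of vertices of the power
graph, so a network decomposition of the power graph is a scheduling. -/
lemma isScheduling_of_computesND {c n k d T : ℕ} (Δ r : ℕ) {A : LocalAlg Unit ℕ}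
    (hA : A.ComputesND c n k d T) :
    IsScheduling c n Δ r ((r + 2) * T) k ((r + 2) * d)
      fun H e => A.out (idState A (distPower H (r + 2)) T e.inf) := by
  intro G ident _ hid
  have hND := hA (distPower G (r + 2)) ident hid
  set f := A.outputAfter (distPower G (r + 2)) ident (fun _ => ()) T with hf
  have hout : ∀ v, A.out (idState A (distPower (G.map ident) (r + 2)) T (ident v)) = f v := by
    intro v
    rw [hf, LocalAlg.outputAfter, stateAfter_eq_idState, distPower_map]
  refine ⟨?_, ?_, ?_⟩
  · intro I X Y _ e _ hag
    simp only [idState_distPower_eq_of_agree A hag]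
  · intro e he
    obtain ⟨u, hu⟩ := exists_inf_eq he
    simp only [hu, hout]
    exact hND.1 u
  · intro e g heg
    rcases heg.cases_head with rfl | ⟨_, ⟨⟨he, -⟩, -⟩, -⟩
    · simp
    obtain ⟨u, hu⟩ := exists_inf_eq he
    have key : ∃ w, g.inf = ident w ∧ ∃ hw : f w = f u,
        ((distPower G (r + 2)).induce {w | f w = f u}).Reachable ⟨u, rfl⟩ ⟨w, hw⟩ := by
      induction heg with
      | refl => exact ⟨u, hu, rfl, Reachable.refl _⟩
      | @tail g g' _ hstep ih =>
        obtain ⟨w, hgw, hw, hreach⟩ := ih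
        obtain ⟨hn, hc⟩ := hstep
        have hd := hn.edist_le (inf_mem g) (inf_mem g')
        rw [hgw] at hd
        obtain ⟨w', hw'⟩ := mem_range_of_edist_map_le hd
        simp only [hgw, hw', hout] at hc
        rw [hw', edist_map_embedding] at hd
        have hw'' : f w' = f u := hc ▸ hw
        refine ⟨w', hw', hw'', hreach.trans ?_⟩
        by_cases hww : w = w'
        · subst hww
          exact Reachable.refl _
        · have : ((distPower G (r + 2)).induce {w | f w = f u}).Adj ⟨w, hw⟩ ⟨w', hw''⟩ :=
            ⟨hww, hd⟩
          exact this.reachable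
    obtain ⟨w, hgw, hw, hreach⟩ := key
    obtain ⟨p, hp⟩ := hreach.exists_walk_length_eq_dist
    rw [hu, hgw, edist_map_embedding]
    refine (edist_le_of_walk_induce_distPower p).trans ?_
    rw [hp]
    exact_mod_cast Nat.mul_le_mul_left _ (hND.2 (f u) _ _ hreach)

/-- With a single color, the chains stay within a connected component. -/
lemma isScheduling_const (c n Δ r : ℕ) : IsScheduling c n Δ r 0 1 n fun _ _ => 0 := by
  intro G ident _ _
  refine ⟨fun _ _ _ _ _ _ _ => rfl, fun _ _ => one_pos, ?_⟩
  intro e g heg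
  rcases heg.cases_head with rfl | ⟨_, ⟨⟨he, -⟩, -⟩, -⟩
  · simp
  obtain ⟨u, hu⟩ := exists_inf_eq he
  have key : ∃ w, g.inf = ident w ∧ G.Reachable u w := by
    induction heg with
    | refl => exact ⟨u, hu, Reachable.refl _⟩
    | @tail g g' _ hstep ih =>
      obtain ⟨w, hgw, hreach⟩ := ih
      have hd := hstep.1.edist_le (inf_mem g) (inf_mem g')
      rw [hgw] at hd
      obtain ⟨w', hw'⟩ := mem_range_of_edist_map_le hd
      rw [hw', edist_map_embedding] at hd
      exact ⟨w', hw', hreach.trans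
        (reachable_of_edist_ne_top (ne_top_of_le_ne_top (ENat.natCast_ne_top _) hd))⟩
  obtain ⟨w, hgw, hreach⟩ := key
  rw [hu, hgw, edist_map_embedding]
  obtain ⟨p, hp⟩ := hreach.exists_isPath
  refine edist_le_iff_exists_walk.2 ⟨p, ?_⟩
  simpa using hp.length_lt.le

lemma exists_computesND_le_ndTime {c a n : ℕ} (h : ndTime c a n ≠ ⊤) :
    ∃ (T : ℕ) (A : LocalAlg Unit ℕ),
      A.ComputesND c n (a * (Nat.log 2 n + 1)) (a * (Nat.log 2 n + 1)) T ∧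
        (T : ℕ∞) ≤ ndTime c a n := by
  classical
  by_cases hex : ∃ t, ∃ A : LocalAlg Unit ℕ,
      A.ComputesND c n (a * (Nat.log 2 n + 1)) (a * (Nat.log 2 n + 1)) t
  · obtain ⟨A, hA⟩ := Nat.find_spec hex
    refine ⟨Nat.find hex, A, hA, le_iInf₂ fun t ht => ?_⟩
    exact_mod_cast Nat.find_min' hex ht
  · refine absurd ?_ h
    rw [ndTime]
    simp only [iInf_eq_top]
    exact fun t ht => absurd ⟨t, ht⟩ hex

theorem edgeSLOCAL_subset_LOCAL_ndTime (c a r : ℕ) (I O : Type) :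
    (EdgeSLOCAL c (r + 1) : Set (EdgeProblem I O)) ⊆
      LOCAL c (fun n _ => ((4 * a * (2 * a + 1) + 3 : ℕ) : ℕ∞) *
        (((r + 1 : ℕ) : ℕ∞) * (Nat.log 2 n : ℕ∞) ^ 2 + ((r + 1 : ℕ) : ℕ∞) * ndTime c a n)) := by
  intro P hP
  refine mem_LOCAL_of_isScheduling hP fun n Δ => ?_
  rcases Nat.lt_or_ge n 2 with hn | hn
  · refine Or.inl fun G _ => ?_
    have : Subsingleton (Fin n) := by
      rw [Fin.subsingleton_iff_le_one]
      omega
    exact Subsingleton.elim _ _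
  right
  by_cases hT : ndTime c a n = ⊤
  · refine ⟨_, _, _, _, isScheduling_const c n Δ r, ?_⟩
    rw [hT, ENat.mul_top (by simp), add_top, ENat.mul_top (by simp)]
    exact le_top
  · obtain ⟨T, A, hA, hle⟩ := exists_computesND_le_ndTime hT
    refine ⟨_, _, _, _, isScheduling_of_computesND Δ r hA, le_trans ?_
      (mul_le_mul_right (add_le_add_right (mul_le_mul_right hle _) _) _)⟩
    have hlog : 1 ≤ Nat.log 2 n := Nat.log_pos (by norm_num) hn
    generalize Nat.log 2 n = L at hlog ⊢
    norm_cast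
    have h1 : a * (L + 1) ≤ 2 * a * L := by nlinarith
    have h2 : a * (L + 1) + 1 ≤ (2 * a + 1) * L := by nlinarith
    have h3 := Nat.mul_le_mul h1 h2
    calc (r + 2) * T + a * (L + 1) * ((r + 2) * (a * (L + 1)) + r + 2) + 1
        = (r + 2) * T + (r + 2) * (a * (L + 1) * (a * (L + 1) + 1)) + 1 := by ring
      _ ≤ 2 * (r + 1) * T + 2 * (r + 1) * (2 * a * L * ((2 * a + 1) * L)) + (r + 1) * L ^ 2 := by
        refine Nat.add_le_add (Nat.add_le_add (Nat.mul_le_mul_right _ (by omega))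
          (Nat.mul_le_mul (by omega) h3)) ?_
        exact Nat.mul_pos (Nat.succ_pos r) (Nat.pow_pos hlog)
      _ ≤ (4 * a * (2 * a + 1) + 3) * ((r + 1) * L ^ 2 + (r + 1) * T) := by
        have : 0 ≤ (4 * a * (2 * a + 1) + 1) * ((r + 1) * T) + 2 * ((r + 1) * L ^ 2) :=
          Nat.zero_le _
        nlinarith

/-! ### Color reduction -/

/-- Iterated recoloring of the vertices of the conflict graph `C`: in round `i` the rule `Φ i` maps
the own color and the set of the colors of the neighbors to a new color. -/
def recolor {V : Type} (C : SimpleGraph V) (Φ : ℕ → ℕ → Set ℕ → ℕ) (γ : V → ℕ) : ℕ → V → ℕ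
  | 0 => γ
  | i + 1 => fun v => Φ i (recolor C Φ γ i v) {k | ∃ u, C.Adj v u ∧ k = recolor C Φ γ i u}

/-- `γ` is a proper coloring of `C` with the colors `0, …, m - 1`. -/
def IsProperColoring {V : Type} (C : SimpleGraph V) (m : ℕ) (γ : V → ℕ) : Prop :=
  (∀ v, γ v < m) ∧ ∀ u v, C.Adj u v → γ u ≠ γ v

/-- Some recoloring rule turns every proper `m`-coloring of a graph with degrees at most `D` into a
proper `m'`-coloring within `t` rounds. -/
def ReducesColors (D t m m' : ℕ) : Prop :=
  ∃ Φ : ℕ → ℕ → Set ℕ → ℕ, ∀ (V : Type) (C : SimpleGraph V),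
    (∀ v, (C.neighborSet v).encard ≤ D) → ∀ γ, IsProperColoring C m γ →
      IsProperColoring C m' (recolor C Φ γ t)

lemma ReducesColors.refl (D m : ℕ) : ReducesColors D 0 m m :=
  ⟨fun _ c _ => c, fun _ _ _ _ h => h⟩

lemma ReducesColors.mono {D t m₀ m m' m₁ : ℕ} (h : ReducesColors D t m m') (h₀ : m₀ ≤ m)
    (h₁ : m' ≤ m₁) : ReducesColors D t m₀ m₁ := by
  obtain ⟨Φ, hΦ⟩ := h
  refine ⟨Φ, fun V C hC γ hγ => ?_⟩
  obtain ⟨h2, h3⟩ := hΦ V C hC γ ⟨fun v => (hγ.1 v).trans_le h₀, hγ.2⟩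
  exact ⟨fun v => (h2 v).trans_le h₁, h3⟩

lemma ReducesColors.trans {D t₁ t₂ m₁ m₂ m₃ : ℕ} (h₁ : ReducesColors D t₁ m₁ m₂)
    (h₂ : ReducesColors D t₂ m₂ m₃) : ReducesColors D (t₁ + t₂) m₁ m₃ := by
  obtain ⟨Φ₁, hΦ₁⟩ := h₁
  obtain ⟨Φ₂, hΦ₂⟩ := h₂
  refine ⟨fun i => if i < t₁ then Φ₁ i else Φ₂ (i - t₁), fun V C hC γ hγ => ?_⟩
  have e₁ : ∀ i ≤ t₁, recolor C (fun i => if i < t₁ then Φ₁ i else Φ₂ (i - t₁)) γ i =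
      recolor C Φ₁ γ i := by
    intro i
    induction i with
    | zero => intro _; rfl
    | succ i ih =>
      intro hi
      simp only [recolor, ih (by omega), if_pos (show i < t₁ by omega)]
  have e₂ : ∀ i, recolor C (fun i => if i < t₁ then Φ₁ i else Φ₂ (i - t₁)) γ (t₁ + i) =
      recolor C Φ₂ (recolor C Φ₁ γ t₁) i := by
    intro i
    induction i with
    | zero => exact e₁ t₁ le_rfl
    | succ i ih =>
      rw [← add_assoc]
      simp only [recolor, ih, if_neg (show ¬ t₁ + i < t₁ by omega), Nat.add_sub_cancel_left]
  rw [e₂]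
  exact hΦ₂ V C hC _ (hΦ₁ V C hC γ hγ)

/-- Polynomials of degree at most `d` over `ZMod q`: there are `q ^ (d + 1)` of them, and two of them
agree in at most `d` points. -/
lemma exists_family_agreeing_rarely {q d m : ℕ} [Fact q.Prime] (hm : m ≤ q ^ (d + 1)) :
    ∃ ev : ℕ → ZMod q → ZMod q, ∀ k < m, ∀ k' < m, k ≠ k' →
      (Finset.univ.filter fun x => ev k' x = ev k x).card ≤ d := by
  classical
  have hcard : Fintype.card (Fin m) ≤ Fintype.card (Fin (d + 1) → ZMod q) := by
    simpa [ZMod.card] using hm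
  obtain ⟨φ⟩ := Function.Embedding.nonempty_of_card_le hcard
  let p : (Fin (d + 1) → ZMod q) → Polynomial (ZMod q) := fun a =>
    ((Polynomial.degreeLTEquiv (ZMod q) (d + 1)).symm a : Polynomial (ZMod q))
  have hp : Function.Injective p :=
    Subtype.val_injective.comp (Polynomial.degreeLTEquiv (ZMod q) (d + 1)).symm.injective
  have hdeg : ∀ a, (p a).degree < (d + 1 : ℕ) := fun a =>
    Polynomial.mem_degreeLT.1 ((Polynomial.degreeLTEquiv (ZMod q) (d + 1)).symm a).2
  refine ⟨fun k x => if h : k < m then (p (φ ⟨k, h⟩)).eval x else 0, ?_⟩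
  intro k hk k' hk' hne
  simp only [dif_pos hk, dif_pos hk']
  set f := p (φ ⟨k', hk'⟩) - p (φ ⟨k, hk⟩) with hf
  have hf0 : f ≠ 0 := by
    rw [hf, sub_ne_zero]
    intro h
    have := φ.injective (hp h)
    simp only [Fin.mk.injEq] at this
    exact hne this.symm
  have hfd : f.natDegree ≤ d := by
    have : f.degree < (d + 1 : ℕ) :=
      (Polynomial.degree_sub_le _ _).trans_lt (max_lt (hdeg _) (hdeg _))
    rw [Polynomial.degree_eq_natDegree hf0] at this
    exact Nat.lt_succ_iff.1 (by exact_mod_cast this)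
  refine (Polynomial.card_le_degree_of_subset_roots (p := f) ?_).trans hfd
  intro x hx
  have hx' : (p (φ ⟨k', hk'⟩)).eval x = (p (φ ⟨k, hk⟩)).eval x := by simpa using hx
  rw [Polynomial.mem_roots hf0, Polynomial.IsRoot, hf, Polynomial.eval_sub, hx', sub_self]

/-- Linial's color reduction: every vertex picks a point where the polynomial of its color differs
from those of all its neighbors; the new color is the point together with the value there. -/
lemma reducesColors_sq {D q d m : ℕ} (hq : q.Prime) (hd : d * D < q) (hm : m ≤ q ^ (d + 1)) :
    ReducesColors D 1 m (q ^ 2) := by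
  classical
  have : Fact q.Prime := ⟨hq⟩
  obtain ⟨ev, hev⟩ := exists_family_agreeing_rarely hm
  let code : ZMod q → ZMod q → ℕ := fun x y => q * x.val + y.val
  have hcode_lt : ∀ x y, code x y < q ^ 2 := by
    intro x y
    have h1 := ZMod.val_lt x
    have h2 := ZMod.val_lt y
    simp only [code]
    nlinarith
  have hcode_inj : ∀ x y x' y', code x y = code x' y' → x = x' ∧ y = y' := by
    intro x y x' y' h
    have h1 := congrArg (· / q) h
    have h2 := congrArg (· % q) h
    simp only [code, Nat.mul_add_div hq.pos, Nat.mul_add_mod, Nat.div_eq_of_lt (ZMod.val_lt _),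
      Nat.mod_eq_of_lt (ZMod.val_lt _), add_zero] at h1 h2
    exact ⟨ZMod.val_injective q h1, ZMod.val_injective q h2⟩
  let Φ : ℕ → Set ℕ → ℕ := fun k S =>
    if h : ∃ x, ∀ k' ∈ S, ev k' x ≠ ev k x then code h.choose (ev k h.choose) else 0
  refine ⟨fun _ => Φ, fun V C hC γ hγ => ?_⟩
  have key : ∀ v, ∃ x, recolor C (fun _ => Φ) γ 1 v = code x (ev (γ v) x) ∧
      ∀ u, C.Adj v u → ev (γ u) x ≠ ev (γ v) x := by
    intro v
    have hfin : (C.neighborSet v).Finite :=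
      Set.finite_of_encard_le_coe (hC v)
    have hex : ∃ x, ∀ k' ∈ {k | ∃ u, C.Adj v u ∧ k = γ u}, ev k' x ≠ ev (γ v) x := by
      by_contra hcon
      push Not at hcon
      have hcover : (Finset.univ : Finset (ZMod q)) ⊆ hfin.toFinset.biUnion fun u =>
          Finset.univ.filter fun x => ev (γ u) x = ev (γ v) x := by
        intro x _
        obtain ⟨k', ⟨u, hu, rfl⟩, hx⟩ := hcon x
        simp only [Finset.mem_biUnion, Set.Finite.mem_toFinset, mem_neighborSet,
          Finset.mem_filter, Finset.mem_univ, true_and]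
        exact ⟨u, hu, hx⟩
      have h1 := (Finset.card_le_card hcover).trans (Finset.card_biUnion_le_card_mul _ _ d ?_)
      · rw [Finset.card_univ, ZMod.card] at h1
        have h2 : hfin.toFinset.card ≤ D := by
          have := hC v
          rw [hfin.encard_eq_coe_toFinset_card] at this
          exact_mod_cast this
        have h3 := Nat.mul_le_mul_right d h2
        rw [mul_comm D d] at h3
        omega
      · intro u hu
        have hu' : C.Adj v u := by simpa using hu
        exact hev _ (hγ.1 v) _ (hγ.1 u) (hγ.2 v u hu')
    refine ⟨hex.choose, dif_pos hex, fun u hu => hex.choose_spec _ ⟨u, hu, rfl⟩⟩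
  refine ⟨fun v => ?_, fun u v huv h => ?_⟩
  · obtain ⟨x, hx, -⟩ := key v
    rw [hx]
    exact hcode_lt _ _
  · obtain ⟨x, hx, hxu⟩ := key u
    obtain ⟨y, hy, -⟩ := key v
    rw [hx, hy] at h
    obtain ⟨rfl, h⟩ := hcode_inj _ _ _ _ h
    exact hxu v huv h.symm

section AdditiveReduction

variable {V : Type} {C : SimpleGraph V} {D q : ℕ} {a b : ℕ → V → ℕ}

/-- The dynamics of the additive color reduction, for colors `(a, b)`: a vertex that shares `b` with
a neighbor adds `a` to `b` modulo `q`, any other vertex settles at the color `(0, b)`. -/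
structure IsAdditiveReduction (C : SimpleGraph V) (q : ℕ) (a b : ℕ → V → ℕ) : Prop where
  lt_left : ∀ t v, a t v < q
  lt_right : ∀ t v, b t v < q
  step : ∀ t v,
    ((∃ u, C.Adj v u ∧ b t u = b t v) ∧ a (t + 1) v = a t v ∧
      b (t + 1) v = (b t v + a t v) % q) ∨
    ((¬ ∃ u, C.Adj v u ∧ b t u = b t v) ∧ a (t + 1) v = 0 ∧ b (t + 1) v = b t v)
  proper : ∀ u v, C.Adj u v → ¬ (a 0 u = a 0 v ∧ b 0 u = b 0 v)

namespace IsAdditiveReduction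

lemma settled (h : IsAdditiveReduction C q a b) {s t : ℕ} (hst : s ≤ t) {v : V}
    (hs : a s v = 0) : a t v = 0 ∧ b t v = b s v := by
  induction t, hst using Nat.le_induction with
  | base => exact ⟨hs, rfl⟩
  | succ t _ ih =>
    rcases h.step t v with ⟨-, h1, h2⟩ | ⟨-, h1, h2⟩
    · rw [h1, h2, ih.1, add_zero, Nat.mod_eq_of_lt (h.lt_right t v)]
      exact ⟨rfl, ih.2⟩
    · rw [h1, h2]
      exact ⟨rfl, ih.2⟩

lemma moving (h : IsAdditiveReduction C q a b) (s k : ℕ) {v : V} (hv : a (s + k) v ≠ 0) :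
    a s v = a (s + k) v ∧ (b (s + k) v : ZMod q) = b s v + k * a s v := by
  induction k with
  | zero => simp
  | succ k ih =>
    rw [← add_assoc] at hv ⊢
    rcases h.step (s + k) v with ⟨-, h1, h2⟩ | ⟨-, h1, h2⟩
    · rw [h1] at hv ⊢
      obtain ⟨ih1, ih2⟩ := ih hv
      refine ⟨ih1, ?_⟩
      rw [h2, ZMod.natCast_mod, Nat.cast_add, ih2, ← ih1]
      push_cast
      ring
    · exact absurd h1 hv

lemma proper_at (h : IsAdditiveReduction C q a b) (t : ℕ) {u v : V} (huv : C.Adj u v) :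
    ¬ (a t u = a t v ∧ b t u = b t v) := by
  induction t generalizing u v with
  | zero => exact h.proper u v huv
  | succ t ih =>
    -- A vertex that settles at `(0, b)` avoids the value `b` of each neighbor, in particular of those
    -- with `a = 0`, which keep it.
    have mixed : ∀ u v, C.Adj u v → (¬ ∃ w, C.Adj u w ∧ b t w = b t u) → a (t + 1) u = 0 →
        b (t + 1) u = b t u → a (t + 1) v = a t v → b (t + 1) v = (b t v + a t v) % q →
        ¬ (a (t + 1) u = a (t + 1) v ∧ b (t + 1) u = b (t + 1) v) := by
      rintro u v huv hno h1 h2 h3 h4 ⟨e1, e2⟩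
      rw [h1, h3] at e1
      rw [h2, h4, ← e1, add_zero, Nat.mod_eq_of_lt (h.lt_right t v)] at e2
      exact hno ⟨v, huv, e2.symm⟩
    rcases h.step t u with ⟨-, h1, h2⟩ | ⟨hno, h1, h2⟩ <;>
      rcases h.step t v with ⟨-, h3, h4⟩ | ⟨hno', h3, h4⟩
    · rintro ⟨e1, e2⟩
      rw [h1, h3] at e1
      rw [h2, h4, e1] at e2
      refine ih huv ⟨e1, ?_⟩
      have e3 : b t u ≡ b t v [MOD q] := Nat.ModEq.add_right_cancel' _ e2
      exact Nat.ModEq.eq_of_lt_of_lt e3 (h.lt_right t u) (h.lt_right t v)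
    · rintro ⟨e1, e2⟩
      exact mixed v u huv.symm hno' h3 h4 h1 h2 ⟨e1.symm, e2.symm⟩
    · exact mixed u v huv hno h1 h2 h3 h4
    · rintro ⟨-, e2⟩
      rw [h2, h4] at e2
      exact hno ⟨v, huv, e2.symm⟩

/-- Within `q` rounds, a moving vertex meets each neighbor at most once while that neighbor moves and
at most once after it has settled. So it cannot be blocked in all `q > 2 * D` rounds. -/
lemma eq_zero (h : IsAdditiveReduction C q a b) (hq : q.Prime) (hD : 2 * D < q) {v : V}
    (hC : (C.neighborSet v).encard ≤ D) : a q v = 0 := by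
  classical
  have : Fact q.Prime := ⟨hq⟩
  have : Nonempty V := ⟨v⟩
  by_contra hv
  have hconf : ∀ t < q, ∃ u, C.Adj v u ∧ b t u = b t v := by
    intro t ht
    rcases h.step t v with ⟨h1, -⟩ | ⟨-, h1, -⟩
    · exact h1
    · exact absurd (h.settled ht h1).1 hv
  have hne : ∀ t ≤ q, a t v ≠ 0 := fun t ht h0 => hv (h.settled ht h0).1
  choose! u hu hbu using hconf
  have hfin : (C.neighborSet v).Finite := Set.finite_of_encard_le_coe hC
  have hcard : hfin.toFinset.card ≤ D := by
    rw [hfin.encard_eq_coe_toFinset_card] at hC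
    exact_mod_cast hC
  have hpigeon : ∃ s ∈ Finset.range q, ∃ t ∈ Finset.range q, s ≠ t ∧
      (u s, decide (a s (u s) = 0)) = (u t, decide (a t (u t) = 0)) := by
    refine Finset.exists_ne_map_eq_of_card_lt_of_maps_to
      (t := hfin.toFinset ×ˢ (Finset.univ : Finset Bool)) ?_ ?_
    · rw [Finset.card_product, Finset.card_univ, Fintype.card_bool, Finset.card_range]
      omega
    · intro t ht
      simp only [Finset.coe_product, Set.mem_prod, Finset.mem_coe, Set.Finite.mem_toFinset,
        mem_neighborSet, Finset.mem_univ, and_true]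
      exact hu t (by simpa using ht)
  have main : ∀ s k, 0 < k → s + k < q → u s = u (s + k) →
      (a s (u s) = 0 ↔ a (s + k) (u (s + k)) = 0) → False := by
    intro s k hk hlt hus hflag
    have hk0 : (k : ZMod q) ≠ 0 := by
      rw [Ne, ZMod.natCast_eq_zero_iff]
      exact Nat.not_dvd_of_pos_of_lt hk (by omega)
    obtain ⟨hv1, hv2⟩ := h.moving s k (hne (s + k) hlt.le)
    have hb1 := hbu s (by omega)
    have hb2 := hbu (s + k) hlt
    rw [← hus] at hb2 hflag
    by_cases h0 : a s (u s) = 0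
    · have hb3 := (h.settled (Nat.le_add_right s k) h0).2
      rw [← hb2, hb3, hb1] at hv2
      have h1 : (k : ZMod q) * a s v = 0 := by
        simpa using hv2
      rcases mul_eq_zero.1 h1 with h1 | h1
      · exact hk0 h1
      · rw [ZMod.natCast_eq_zero_iff] at h1
        exact hne s (by omega) (Nat.eq_zero_of_dvd_of_lt h1 (h.lt_left s v))
    · obtain ⟨hu1, hu2⟩ := h.moving s k (fun h1 => h0 (hflag.2 h1))
      rw [hb2, hv2, hb1] at hu2
      have h1 : (a s v : ZMod q) = a s (u s) := mul_left_cancel₀ hk0 (add_left_cancel hu2)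
      have h2 : a s v = a s (u s) := Nat.ModEq.eq_of_lt_of_lt
        ((ZMod.natCast_eq_natCast_iff _ _ q).1 h1) (h.lt_left _ _) (h.lt_left _ _)
      exact h.proper_at s (hu s (by omega)).symm ⟨h2.symm, hb1⟩
  obtain ⟨s, hs, t, ht, hst, heq⟩ := hpigeon
  rw [Finset.mem_range] at hs ht
  rw [Prod.mk.injEq, decide_eq_decide] at heq
  rcases Nat.lt_or_gt_of_ne hst with hlt | hlt
  · obtain ⟨k, rfl⟩ := Nat.exists_eq_add_of_lt hlt
    exact main s (k + 1) k.succ_pos ht heq.1 heq.2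
  · obtain ⟨k, rfl⟩ := Nat.exists_eq_add_of_lt hlt
    exact main t (k + 1) k.succ_pos hs heq.1.symm heq.2.symm

end IsAdditiveReduction

/-- The additive reduction from `q ^ 2` to `q` colors in `q` rounds; the color `q * a + b` stands for
the pair `(a, b)`. -/
lemma reducesColors_of_sq (hq : q.Prime) (hD : 2 * D < q) : ReducesColors D q (q ^ 2) q := by
  classical
  let Φ : ℕ → Set ℕ → ℕ := fun k S =>
    if ∃ k' ∈ S, k' % q = k % q then q * (k / q) + (k % q + k / q) % q else k % q
  refine ⟨fun _ => Φ, fun V C hC γ hγ => ?_⟩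
  set g := recolor C (fun _ => Φ) γ with hg
  have hmod : ∀ k, k % q < q := fun k => Nat.mod_lt _ hq.pos
  have hconf : ∀ t v, (∃ k' ∈ {k | ∃ u, C.Adj v u ∧ k = g t u}, k' % q = g t v % q) ↔
      ∃ u, C.Adj v u ∧ g t u % q = g t v % q := by
    intro t v
    constructor
    · rintro ⟨_, ⟨u, hu, rfl⟩, h⟩
      exact ⟨u, hu, h⟩
    · rintro ⟨u, hu, h⟩
      exact ⟨_, ⟨u, hu, rfl⟩, h⟩
  have hstep : ∀ t v, ((∃ u, C.Adj v u ∧ g t u % q = g t v % q) ∧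
      g (t + 1) v = q * (g t v / q) + (g t v % q + g t v / q) % q) ∨
      ((¬ ∃ u, C.Adj v u ∧ g t u % q = g t v % q) ∧ g (t + 1) v = g t v % q) := by
    intro t v
    by_cases h : ∃ u, C.Adj v u ∧ g t u % q = g t v % q
    · exact Or.inl ⟨h, if_pos ((hconf t v).2 h)⟩
    · exact Or.inr ⟨h, if_neg (fun h' => h ((hconf t v).1 h'))⟩
  have hred : IsAdditiveReduction C q (fun t v => g t v / q) (fun t v => g t v % q) := by
    refine ⟨?_, fun t v => hmod _, ?_, ?_⟩
    · intro t v
      induction t with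
      | zero =>
        refine Nat.div_lt_of_lt_mul ?_
        rw [← sq]
        exact hγ.1 v
      | succ t ih =>
        rcases hstep t v with ⟨-, h⟩ | ⟨-, h⟩
        · rw [h, Nat.mul_add_div hq.pos, Nat.div_eq_of_lt (hmod _), add_zero]
          exact ih
        · rw [h, Nat.div_eq_of_lt (hmod _)]
          exact hq.pos
    · intro t v
      rcases hstep t v with ⟨h1, h⟩ | ⟨h1, h⟩
      · refine Or.inl ⟨h1, ?_, ?_⟩
        · simp only [h, Nat.mul_add_div hq.pos, Nat.div_eq_of_lt (hmod _), add_zero]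
        · simp only [h, Nat.mul_add_mod, Nat.mod_mod]
      · refine Or.inr ⟨h1, ?_, ?_⟩
        · simp only [h, Nat.div_eq_of_lt (hmod _)]
        · simp only [h, Nat.mod_mod]
    · rintro u v huv ⟨h1, h2⟩
      refine hγ.2 u v huv ?_
      change γ u / q = γ v / q at h1
      change γ u % q = γ v % q at h2
      rw [← Nat.div_add_mod (γ u) q, h1, h2, Nat.div_add_mod]
  have hzero : ∀ v, g q v / q = 0 := fun v => hred.eq_zero hq hD (hC v)
  refine ⟨fun v => ?_, fun u v huv h => ?_⟩
  · exact ((Nat.div_eq_zero_iff).1 (hzero v)).resolve_left hq.ne_zero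
  · exact hred.proper_at q huv ⟨(hzero u).trans (hzero v).symm, congrArg (· % q) h⟩

end AdditiveReduction

/-! ### The number of rounds of the color reduction -/

lemma clog_mul_le (a b : ℕ) : Nat.clog 2 (a * b) ≤ Nat.clog 2 a + Nat.clog 2 b := by
  refine Nat.clog_le_of_le_pow ?_
  rw [pow_add]
  exact Nat.mul_le_mul (Nat.le_pow_clog one_lt_two a) (Nat.le_pow_clog one_lt_two b)

lemma clog_add_one_le (a : ℕ) : Nat.clog 2 (a + 1) ≤ Nat.clog 2 a + 1 := by
  refine Nat.clog_le_of_le_pow ?_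
  have h1 := Nat.le_pow_clog one_lt_two a
  have h2 : 1 ≤ 2 ^ Nat.clog 2 a := Nat.one_le_two_pow
  rw [pow_succ]
  omega

lemma clog_iterate_logStar_le (n : ℕ) : (Nat.clog 2)^[logStar n] n ≤ 1 := by
  refine Nat.sInf_mem (s := {k : ℕ | (Nat.clog 2)^[k] n ≤ 1}) ?_
  induction n using Nat.strong_induction_on with
  | _ n ih =>
  rcases Nat.lt_or_ge n 2 with hn | hn
  · exact ⟨0, Nat.lt_succ_iff.1 hn⟩
  · have hlt : Nat.clog 2 n < n := by
      have : Nat.clog 2 n ≤ n - 1 := by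
        refine Nat.clog_le_of_le_pow ?_
        have := Nat.lt_two_pow_self (n := n - 1)
        omega
      omega
    obtain ⟨k, hk⟩ := ih _ hlt
    exact ⟨k + 1, hk⟩

/-- A bound for the number of colors after one round of Linial's reduction of `m` colors. -/
def linialBound (D m : ℕ) : ℕ := (2 * (D * (Nat.clog 2 m + 1))) ^ 2

lemma reducesColors_linialBound {D : ℕ} (hD : 0 < D) (m : ℕ) :
    ReducesColors D 1 m (linialBound D m) := by
  obtain ⟨q, hq, h1, h2⟩ := Nat.exists_prime_lt_and_le_two_mul (D * (Nat.clog 2 m + 1))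
    (Nat.mul_pos hD (Nat.succ_pos _)).ne'
  refine (reducesColors_sq (d := Nat.clog 2 m) hq ?_ ?_).mono le_rfl (Nat.pow_le_pow_left h2 2)
  · refine lt_of_le_of_lt ?_ h1
    rw [mul_comm]
    exact Nat.mul_le_mul_left _ (Nat.le_succ _)
  · calc m ≤ 2 ^ Nat.clog 2 m := Nat.le_pow_clog one_lt_two m
      _ ≤ q ^ Nat.clog 2 m := Nat.pow_le_pow_left hq.two_le _
      _ ≤ q ^ (Nat.clog 2 m + 1) := Nat.pow_le_pow_right hq.pos (Nat.le_succ _)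

lemma reducesColors_iterate_linialBound {D : ℕ} (hD : 0 < D) (m i : ℕ) :
    ReducesColors D i m ((linialBound D)^[i] m) := by
  induction i with
  | zero => exact ReducesColors.refl D m
  | succ i ih =>
    rw [Function.iterate_succ_apply']
    exact ih.trans (reducesColors_linialBound hD _)

lemma clog_linialBound_le {B D m x : ℕ} (hB : 8 + 2 * Nat.clog 2 (B + 1) ≤ B)
    (hm : Nat.clog 2 m ≤ B + B * x + 4 * Nat.clog 2 D) :
    Nat.clog 2 (linialBound D m) ≤ B + B * Nat.clog 2 x + 4 * Nat.clog 2 D := by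
  set k := Nat.clog 2 D with hk
  have h1 : Nat.clog 2 (4 * k + 1) ≤ k + 2 := by
    refine Nat.clog_le_of_le_pow ?_
    have := Nat.lt_two_pow_self (n := k)
    rw [pow_add]
    omega
  have h2 : Nat.clog 2 (Nat.clog 2 m + 1) ≤
      Nat.clog 2 (B + 1) + (Nat.clog 2 x + 1) + (k + 2) := by
    have h3 : Nat.clog 2 m + 1 ≤ (B + 1) * (x + 1) * (4 * k + 1) := by
      have : 0 ≤ x + 4 * k * (B + B * x + x) := Nat.zero_le _
      nlinarith
    have h4 := (clog_mul_le ((B + 1) * (x + 1)) (4 * k + 1))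
    have h5 := clog_mul_le (B + 1) (x + 1)
    have h6 := clog_add_one_le x
    have h7 := Nat.clog_mono_right 2 h3
    omega
  have h3 : Nat.clog 2 (2 * (D * (Nat.clog 2 m + 1))) ≤
      1 + (k + Nat.clog 2 (Nat.clog 2 m + 1)) := by
    refine (clog_mul_le _ _).trans (Nat.add_le_add ?_ (clog_mul_le _ _))
    exact Nat.clog_le_of_le_pow (by norm_num)
  have h4 : Nat.clog 2 (linialBound D m) ≤ 2 * (1 + (k + Nat.clog 2 (Nat.clog 2 m + 1))) := by
    rw [linialBound, sq]
    have := clog_mul_le (2 * (D * (Nat.clog 2 m + 1))) (2 * (D * (Nat.clog 2 m + 1)))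
    omega
  have h5 : 2 * Nat.clog 2 x ≤ B * Nat.clog 2 x := Nat.mul_le_mul_right _ (by omega)
  omega

lemma clog_iterate_linialBound_le {B c D : ℕ} (hB : 8 + 2 * Nat.clog 2 (B + 1) ≤ B)
    (hc : 2 * c ≤ B) (n i : ℕ) :
    Nat.clog 2 ((linialBound D)^[i] (n ^ (2 * c))) ≤
      B + B * (Nat.clog 2)^[i + 1] n + 4 * Nat.clog 2 D := by
  induction i with
  | zero =>
    have h1 : Nat.clog 2 (n ^ (2 * c)) ≤ Nat.clog 2 n * (2 * c) := by
      refine Nat.clog_le_of_le_pow ?_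
      rw [pow_mul 2]
      exact Nat.pow_le_pow_left (Nat.le_pow_clog one_lt_two n) _
    have h2 : Nat.clog 2 n * (2 * c) ≤ B * Nat.clog 2 n := by
      rw [mul_comm]
      exact Nat.mul_le_mul_right _ hc
    simp only [Function.iterate_zero, id, Function.iterate_one, zero_add]
    omega
  | succ i ih =>
    rw [Function.iterate_succ_apply', Function.iterate_succ_apply' _ (i + 1)]
    exact clog_linialBound_le hB ih

/-- `logStar n` rounds of Linial's reduction leave a number of colors that is polynomial in `D`; one
more round and the additive reduction leave a number that is linear in `D`. -/
lemma exists_reducesColors (c : ℕ) {D : ℕ} (hD : 0 < D) (n : ℕ) :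
    ∃ q ≤ 2 ^ (2 ^ (c + 5) + 2) * D,
      ReducesColors D (logStar n + 1 + q) (n ^ (2 * c)) q := by
  set B := 2 ^ (c + 5) with hBdef
  have hc : c < 2 ^ c := Nat.lt_two_pow_self
  have hB32 : B = 32 * 2 ^ c := by
    rw [hBdef, pow_add]
    ring
  have hB : 8 + 2 * Nat.clog 2 (B + 1) ≤ B := by
    have h1 := clog_add_one_le B
    have h2 : Nat.clog 2 B = c + 5 := Nat.clog_pow 2 _ one_lt_two
    omega
  obtain ⟨q, hq, h1, h2⟩ := Nat.exists_prime_lt_and_le_two_mul (2 ^ (B + 1) * D)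
    (Nat.mul_pos (by positivity) hD).ne'
  have hqD : 3 * D < q := by
    refine lt_of_le_of_lt (Nat.mul_le_mul_right D ?_) h1
    calc 3 ≤ 2 ^ 2 := by norm_num
      _ ≤ 2 ^ (B + 1) := Nat.pow_le_pow_right two_pos (by omega)
  refine ⟨q, h2.trans (le_of_eq (by ring)), ?_⟩
  refine ((reducesColors_iterate_linialBound hD (n ^ (2 * c)) (logStar n)).trans
    (reducesColors_sq (d := 3) hq hqD ?_)).trans (reducesColors_of_sq hq (by omega))
  have hclog := clog_iterate_linialBound_le (D := D) hB (c := c) (by omega) n (logStar n)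
  rw [Function.iterate_succ_apply',
    Nat.clog_of_right_le_one (clog_iterate_logStar_le n), mul_zero, add_zero] at hclog
  have hDpow : 2 ^ Nat.clog 2 D ≤ 2 * D := by
    rcases Nat.lt_or_ge 1 D with h | h
    · have h3 := Nat.pow_pred_clog_lt_self one_lt_two h
      have h4 : 0 < Nat.clog 2 D := Nat.clog_pos one_lt_two h
      rw [← Nat.succ_pred_eq_of_pos h4, pow_succ]
      omega
    · rw [Nat.clog_of_right_le_one h]
      omega
  calc (linialBound D)^[logStar n] (n ^ (2 * c))
      ≤ 2 ^ (B + 4 * Nat.clog 2 D) := (Nat.clog_le_iff_le_pow one_lt_two).1 hclog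
    _ ≤ 2 ^ (B * 4 + 4 * Nat.clog 2 D) := Nat.pow_le_pow_right two_pos (by omega)
    _ = (2 ^ B * 2 ^ Nat.clog 2 D) ^ 4 := by
      rw [← pow_add, ← pow_mul]
      ring
    _ ≤ (2 ^ B * (2 * D)) ^ 4 := Nat.pow_le_pow_left (Nat.mul_le_mul_left _ hDpow) _
    _ ≤ q ^ (3 + 1) := by
      refine Nat.pow_le_pow_left (le_of_eq_of_le ?_ h1.le) _
      ring

/-! ### Scheduling by a coloring of the conflict graph -/

section Counting

variable {V : Type*} [DecidableEq V] {G : SimpleGraph V} {N : V → Finset V} {Δ : ℕ}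

lemma exists_finset_ball (hN : ∀ a b, G.Adj a b → b ∈ N a) (hcard : ∀ a, (N a).card ≤ Δ)
    (hΔ : 0 < Δ) (r : ℕ) (a : V) :
    ∃ B : Finset V, B.card ≤ 2 * Δ ^ r ∧ ∀ b, G.edist a b ≤ r → b ∈ B := by
  rcases Nat.lt_or_ge 1 Δ with h2 | h1
  · suffices h : ∃ B : Finset V, B.card + 1 ≤ 2 * Δ ^ r ∧ ∀ b, G.edist a b ≤ r → b ∈ B by
      obtain ⟨B, hB, h⟩ := h
      exact ⟨B, by omega, h⟩
    induction r generalizing a with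
    | zero =>
      refine ⟨{a}, by simp, fun b hb => ?_⟩
      have hab : a = b := by simpa using hb
      simp [hab]
    | succ r ih =>
      choose B hB hmem using ih
      refine ⟨insert a ((N a).biUnion B), ?_, fun b hb => ?_⟩
      · have h3 := Finset.card_biUnion_le_card_mul (N a) B (2 * Δ ^ r - 1)
          (fun u _ => by have := hB u; omega)
        have h4 := h3.trans (Nat.mul_le_mul_right _ (hcard a))
        have h5 := Finset.card_insert_le a ((N a).biUnion B)
        have h6 : Δ * (2 * Δ ^ r - 1) = 2 * Δ ^ (r + 1) - Δ := by
          rw [Nat.mul_sub, pow_succ, mul_one]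
          congr 1
          ring
        have h7 : Δ ≤ 2 * Δ ^ (r + 1) := by
          have := Nat.le_self_pow (Nat.succ_ne_zero r) Δ
          rw [Nat.succ_eq_add_one] at this
          omega
        omega
      · rcases edist_le_succ_iff.1 hb with rfl | ⟨a', ha, hb⟩
        · exact Finset.mem_insert_self _ _
        · exact Finset.mem_insert_of_mem
            (Finset.mem_biUnion.2 ⟨a', hN a a' ha, hmem a' b hb⟩)
  · -- For maximum degree `1` the spheres do not grow geometrically, but the components are edges.
    obtain rfl : Δ = 1 := by omega
    refine ⟨insert a (N a), ?_, fun b hb => ?_⟩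
    · have h3 := Finset.card_insert_le a (N a)
      have h4 := hcard a
      simp only [one_pow]
      omega
    · have h : b = a ∨ G.Adj a b := by
        induction r generalizing a with
        | zero => exact Or.inl (by simpa using hb : a = b).symm
        | succ r ih =>
          rcases edist_le_succ_iff.1 hb with rfl | ⟨a', ha, hb⟩
          · exact Or.inl rfl
          · rcases ih a' hb with rfl | hb
            · exact Or.inr ha
            · exact Or.inl (Finset.card_le_one.1 (hcard a') _ (hN _ _ hb) _ (hN _ _ ha.symm))
      rcases h with rfl | h
      · exact Finset.mem_insert_self _ _
      · exact Finset.mem_insert_of_mem (hN a b h)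

lemma encard_edgesWithin_le (hN : ∀ a b, G.Adj a b → b ∈ N a) (hcard : ∀ a, (N a).card ≤ Δ)
    (hΔ : 0 < Δ) (r : ℕ) (e : Sym2 V) :
    {f | EdgesWithin G r e f}.encard ≤ (4 * Δ ^ (r + 1) : ℕ) := by
  choose B hB hmem using exists_finset_ball hN hcard hΔ r
  induction e with | _ a b
  have hsub : {f | EdgesWithin G r s(a, b) f} ⊆
      (((B a ∪ B b).biUnion fun w => (N w).image fun w' => s(w, w') : Finset (Sym2 V)) :
        Set (Sym2 V)) := by
    rintro f ⟨-, hf, u, hu, w, ⟨w', rfl⟩, huw⟩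
    simp only [Finset.coe_biUnion, Finset.mem_coe, Set.mem_iUnion, Finset.mem_union]
    refine ⟨w, ?_, Finset.mem_image.2 ⟨w', hN w w' hf, rfl⟩⟩
    rcases Sym2.mem_iff.1 hu with rfl | rfl
    · exact Or.inl (hmem _ _ huw)
    · exact Or.inr (hmem _ _ huw)
  refine (Set.encard_le_encard hsub).trans ?_
  rw [Set.encard_coe_eq_coe_finsetCard]
  have h1 := Finset.card_biUnion_le_card_mul (B a ∪ B b)
    (fun w => (N w).image fun w' => s(w, w')) Δ
    (fun w _ => Finset.card_image_le.trans (hcard w))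
  have h2 : (B a ∪ B b).card ≤ 4 * Δ ^ r := by
    have := Finset.card_union_le (B a) (B b)
    have := hB a
    have := hB b
    omega
  have h3 := h1.trans (Nat.mul_le_mul_right Δ h2)
  rw [mul_assoc, ← pow_succ] at h3
  exact_mod_cast h3

end Counting

/-- The graph on the edges of `H` that joins different edges at distance at most `r + 1`. -/
def conflictGraph (H : SimpleGraph ℕ) (r : ℕ) : SimpleGraph (Sym2 ℕ) where
  Adj e f := EdgesWithin H r e f ∧ e ≠ f
  symm.symm _ _ h := ⟨h.1.symm, h.2.symm⟩
  loopless.irrefl _ h := h.2 rfl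

lemma encard_neighborSet_conflictGraph_le {n : ℕ} (G : SimpleGraph (Fin n)) (ident : Fin n ↪ ℕ)
    (hΔ : 0 < graphMaxDegree G) (r : ℕ) (e : Sym2 ℕ) :
    ((conflictGraph (G.map ident) r).neighborSet e).encard ≤
      (4 * graphMaxDegree G ^ (r + 1) : ℕ) := by
  classical
  have hsub : (conflictGraph (G.map ident) r).neighborSet e ⊆
      {f | EdgesWithin (G.map ident) r e f} := fun f hf => hf.1
  refine (Set.encard_le_encard hsub).trans ?_
  refine encard_edgesWithin_le
    (N := fun a => (Finset.univ.filter fun v => (G.map ident).Adj a (ident v)).map ident)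
    ?_ ?_ hΔ r e
  · intro a b hab
    obtain ⟨_, v, _, _, rfl⟩ := (SimpleGraph.map_adj ident G _ _).1 hab
    exact Finset.mem_map.2 ⟨v, by simpa using hab, rfl⟩
  · intro a
    rw [Finset.card_map]
    by_cases ha : ∃ u, ident u = a
    · obtain ⟨u, rfl⟩ := ha
      refine le_trans (le_of_eq ?_) (G.degree_le_maxDegree u)
      rw [← SimpleGraph.card_neighborFinset_eq_degree]
      congr 1
      ext v
      simp
    · rw [Finset.filter_false_of_mem]
      · simp
      · intro v _ h
        obtain ⟨u, _, _, hu, _⟩ := (SimpleGraph.map_adj ident G _ _).1 h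
        exact ha ⟨u, hu⟩

/-- A round of recoloring the conflict graph takes `r + 2` rounds of communication. -/
lemma recolor_conflictGraph_eq_of_agree {I : Type} {X Y : IdGraph I} {r t : ℕ}
    (Φ : ℕ → ℕ → Set ℕ → ℕ) (γ : Sym2 ℕ → ℕ) {e : Sym2 ℕ}
    (h : X.Agree Y (t * (r + 2)) e.inf) :
    recolor (conflictGraph X.graph r) Φ γ t e = recolor (conflictGraph Y.graph r) Φ γ t e := by
  induction t generalizing e with
  | zero => rfl
  | succ t ih =>
    rw [add_mul, one_mul, add_comm] at h
    simp only [recolor]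
    rw [ih (h.mono (by omega))]
    congr 1
    ext k
    simp only [Set.mem_ofPred_eq]
    refine exists_congr fun f => ?_
    have hadj : (conflictGraph X.graph r).Adj e f ↔ (conflictGraph Y.graph r).Adj e f :=
      and_congr_left fun _ =>
        (h.mono (Nat.le_add_right _ _) : X.Agree Y (r + 2) e.inf).edgesWithin_iff (inf_mem e)
    rw [← hadj]
    refine and_congr_right fun hef => ?_
    rw [ih (h.of_edist_le (hef.1.edist_le (inf_mem e) (inf_mem f))).1]

/-- In a proper coloring of the conflict graph all chains are trivial. -/
lemma exists_isScheduling_of_reducesColors {c n Δ r t q : ℕ} (hn : 0 < n) (hΔ : 0 < Δ)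
    (hred : ReducesColors (4 * Δ ^ (r + 1)) t (n ^ (2 * c)) q) :
    ∃ κ, IsScheduling c n Δ r (t * (r + 2)) q 0 κ := by
  obtain ⟨Φ, hΦ⟩ := hred
  let γ : Sym2 ℕ → ℕ := fun e => Nat.pair e.inf e.sup % n ^ (2 * c)
  refine ⟨fun H => recolor (conflictGraph H r) Φ γ t, ?_⟩
  rintro G ident rfl hid
  have hγ : IsProperColoring (conflictGraph (G.map ident) r) (n ^ (2 * c)) γ := by
    refine ⟨fun e => Nat.mod_lt _ (Nat.pow_pos hn), ?_⟩
    have hlt : ∀ e ∈ (G.map ident).edgeSet, Nat.pair e.inf e.sup < n ^ (2 * c) := by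
      intro e he
      obtain ⟨⟨f, hf⟩, rfl⟩ := mem_edgeSet_map_iff.1 he
      induction f with | _ u v
      refine (Nat.pair_lt_max_add_one_sq _ _).trans_le ?_
      rw [mul_comm, pow_mul]
      refine Nat.pow_le_pow_left ?_ 2
      have hu := hid.2 u
      have hv := hid.2 v
      simp only [Sym2.map_mk, Sym2.inf_mk, Sym2.sup_mk]
      omega
    rintro e f ⟨⟨he, hf, -⟩, hne⟩ h
    simp only [γ, Nat.mod_eq_of_lt (hlt e he), Nat.mod_eq_of_lt (hlt f hf)] at h
    exact hne (pair_inf_sup_injective h)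
  obtain ⟨h1, h2⟩ := hΦ _ _ (encard_neighborSet_conflictGraph_le G ident hΔ r) γ hγ
  refine ⟨fun I X Y _ e _ hag => recolor_conflictGraph_eq_of_agree Φ γ hag, fun e _ => h1 e, ?_⟩
  intro e f hef
  have : e = f := by
    induction hef with
    | refl => rfl
    | @tail f g _ hfg ih =>
      subst ih
      by_contra hne
      exact h2 _ _ ⟨hfg.1, hne⟩ hfg.2
  subst this
  simp

theorem edgeSLOCAL_subset_LOCAL_logStar (c r : ℕ) (I O : Type) :
    (EdgeSLOCAL c (r + 1) : Set (EdgeProblem I O)) ⊆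
      LOCAL c (fun n Δ => (((4 * 2 ^ (2 ^ (c + 5) + 4) + 3) * ((r + 1) * Δ ^ (r + 1)) +
        2 * (r + 1) * logStar n : ℕ) : ℕ∞)) := by
  classical
  intro P hP
  refine mem_LOCAL_of_isScheduling hP fun n Δ => ?_
  rcases Nat.eq_zero_or_pos n with rfl | hn
  · exact Or.inl fun G _ => Subsingleton.elim _ _
  rcases Nat.eq_zero_or_pos Δ with rfl | hΔ
  · refine Or.inl fun G hG => ?_
    ext u v
    simp only [bot_adj, iff_false]
    intro huv
    have h1 : 0 < G.degree u := (G.degree_pos_iff_exists_adj u).2 ⟨v, huv⟩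
    have h2 : G.degree u ≤ graphMaxDegree G := G.degree_le_maxDegree u
    omega
  right
  have hp : 0 < Δ ^ (r + 1) := Nat.pow_pos hΔ
  obtain ⟨q, hq, hred⟩ := exists_reducesColors c (D := 4 * Δ ^ (r + 1)) (by omega) n
  obtain ⟨κ, hκ⟩ := exists_isScheduling_of_reducesColors hn hΔ hred
  refine ⟨_, _, _, κ, hκ, ?_⟩
  norm_cast
  generalize Δ ^ (r + 1) = p at hp hq
  have hq' : q ≤ 2 ^ (2 ^ (c + 5) + 4) * p := hq.trans (le_of_eq (by ring))
  generalize 2 ^ (2 ^ (c + 5) + 4) = E at hq'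
  calc (logStar n + 1 + q) * (r + 2) + q * (0 + r + 2) + 1
      = (r + 2) * logStar n + (r + 2) * (1 + 2 * q) + 1 := by ring
    _ ≤ 2 * (r + 1) * logStar n + 2 * (r + 1) * (p + 2 * (E * p)) + (r + 1) * p :=
      Nat.add_le_add (Nat.add_le_add (Nat.mul_le_mul_right _ (by omega))
        (Nat.mul_le_mul (by omega) (by omega))) (Nat.mul_pos r.succ_pos hp)
    _ = (4 * E + 3) * ((r + 1) * p) + 2 * (r + 1) * logStar n := by ring

end EdgeSimulation

theorem corollary2p4 (c : ℕ) (hc : 1 ≤ c) :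
    (∀ a : ℕ, ∃ C : ℕ, ∀ ℓ : ℕ, 0 < ℓ → ∀ I O : Type,
      (EdgeSLOCAL c ℓ : Set (EdgeProblem I O)) ⊆
        LOCAL c (fun n _ =>
          (C : ℕ∞) * ((ℓ : ℕ∞) * (Nat.log 2 n : ℕ∞) ^ 2 + (ℓ : ℕ∞) * ndTime c a n))) ∧
    (∃ C : ℕ, ∀ ℓ : ℕ, 0 < ℓ → ∃ C' : ℕ, ∀ I O : Type,
      (EdgeSLOCAL c ℓ : Set (EdgeProblem I O)) ⊆
        LOCAL c (fun n Δ => ((C * (ℓ * Δ ^ ℓ) + C' * logStar n : ℕ) : ℕ∞))) := by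
  refine ⟨fun a => ⟨4 * a * (2 * a + 1) + 3, fun ℓ hℓ I O => ?_⟩,
    4 * 2 ^ (2 ^ (c + 5) + 4) + 3, fun ℓ hℓ => ⟨2 * ℓ, fun I O => ?_⟩⟩
  · obtain ⟨r, rfl⟩ := Nat.exists_eq_succ_of_ne_zero hℓ.ne'
    exact EdgeSimulation.edgeSLOCAL_subset_LOCAL_ndTime c a r I O
  · obtain ⟨r, rfl⟩ := Nat.exists_eq_succ_of_ne_zero hℓ.ne'
    exact EdgeSimulation.edgeSLOCAL_subset_LOCAL_logStar c r I O
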